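/- Let $G$ be a finite graph, in which loops and multiple edges are allowed, with maximum degree at most $4$ (a loop contributes $2$ to the degree of its vertex). Then $G$ is strongly $22$-edge-choosable: for every assignment $L$ of a finite list $L(e)$ of at least $22$ colors to each edge $e$ of $G$, there is a coloring $c$ of the edges of $G$ with $c(e)\in L(e)$ for every edge $e$ such that $c(e_1)\neq c(e_2)$ whenever $e_1$ and $e_2$ are distinct edges that are adjacent (have a common endpoint) or are both adjacent to a common edge. -/

import Mathlib

universe u v w

open scoped Graph

namespace Graph

/-- The degree of the vertex `v` in a multigraph: the number of edges incident with `v`, where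
each loop at `v` is counted twice. -/
noncomputable def degree {α β : Type*} (G : Graph α β) (v : α) : ℕ∞ :=
  (G.incidenceSet v).encard + (G.loopSet v).encard

/-- The maximum degree of a multigraph (the supremum of the degrees of its vertices). -/
noncomputable def maxDegree {α β : Type*} (G : Graph α β) : ℕ∞ :=
  ⨆ v ∈ V(G), G.degree v

/-- Two edges are adjacent if they are distinct and have a common endpoint. -/
def EdgeAdj {α β : Type*} (G : Graph α β) (e f : β) : Prop :=
  e ≠ f ∧ ∃ x, G.Inc e x ∧ G.Inc f x

/-- A strong edge-coloring: any two distinct edges that are adjacent to each other, or are both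
adjacent to a common edge, receive different colors. -/
def IsStrongEdgeColoring {α β γ : Type*} (G : Graph α β) (c : E(G) → γ) : Prop :=
  ∀ e f : E(G), e ≠ f →
    (G.EdgeAdj e f ∨ ∃ g : β, G.EdgeAdj e g ∧ G.EdgeAdj f g) → c e ≠ c f

/-- `G` has a strong edge-coloring in which every edge gets a color from its list. -/
def IsStronglyListEdgeColorable {α β γ : Type*} (G : Graph α β) (L : E(G) → Finset γ) : Prop :=
  ∃ c : E(G) → γ, G.IsStrongEdgeColoring c ∧ ∀ e, c e ∈ L e

/-- `G` is strongly `k`-edge-choosable: it can be strongly edge-colored from every assignment of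
lists with at least `k` colors each, whatever the set `γ` of colors is. -/
def IsStronglyEdgeChoosable {α : Type u} {β : Type v} (G : Graph α β) (k : ℕ) : Prop :=
  ∀ (γ : Type w) (L : E(G) → Finset γ), (∀ e, k ≤ (L e).card) → G.IsStronglyListEdgeColorable L

end Graph

/-! Encode the multigraph by the map `d` from edges to pairs of ends. The edges in conflict with an
edge `e` all meet one of at most six vertices, the other ends of the edges sharing an end with `e`;
so `e` has at most 24 conflicts. Lists may be cut down to exactly 22 colors.

By induction on the number of edges, all edges outside one component are already colored. In that
component, color towards a vertex set `S`, farthest edges first. An edge not at `S` has an end with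
a neighbor closer to `S`. The edges at that neighbor come later, so at most 20 conflicts matter, and
there is room for one more from a precolored matching `P`. Only edges at `S` can cause trouble; a
set `Q` of them is left for the end and colored by Hall's theorem (`exists_properOn_compl`,
`ProperOn.exists_complete`).

A vertex on fewer than four edges, a loop, a pair of parallel edges or a triangle lowers the number
of conflicts enough at once. What is left is simple, triangle-free and 4-regular up to isolated
vertices (`IsTame`). There `Q` consists of four edges pairwise in conflict, and every edge of `P`
conflicts with all of `Q`. If the colors of `P` seldom occur in the lists of `Q`, the edges of `P`
block fewer colors than their number, which is the gain needed for Hall's condition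
(`exists_properOn_univ_of_clique`).

With a four-cycle, `Q` is its edge set. Each pair of opposite vertices with a further common
neighbor saves a conflict; each pair without one has two edges without conflict, which go into `P`,
with colors from `exists_pair`. Without four-cycles, `Q` is the star of a vertex, and `P` has one
edge at each of its neighbors, pairwise without conflict (`exists_independent_transversal`), with
colors from `exists_quadruple`. -/

namespace EndsMap

open scoped Classical

variable {V : Type u} {E : Type v} {γ : Type w} {d : E → Sym2 V}

/-! ### Conflicts, greedy coloring, and completion by Hall's theorem. -/

/-- The vertices `x` and `y` are ends of a common edge. -/
def Near (d : E → Sym2 V) (x y : V) : Prop := ∃ g, x ∈ d g ∧ y ∈ d g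

/-- Distinct edges that share an end or are joined by an edge. -/
def Conf (d : E → Sym2 V) (e f : E) : Prop :=
  e ≠ f ∧ ∃ x ∈ d e, ∃ y ∈ d f, Near d x y

/-- `c` is a strong coloring from the lists `L` of the edges in `W`. -/
def ProperOn (d : E → Sym2 V) (L : E → Finset γ) (c : E → γ)
    (W : Finset E) : Prop :=
  (∀ e ∈ W, c e ∈ L e) ∧ ∀ e ∈ W, ∀ f ∈ W, Conf d e f → c e ≠ c f

lemma Near.symm {x y : V} (h : Near d x y) : Near d y x := by
  obtain ⟨g, h1, h2⟩ := h
  exact ⟨g, h2, h1⟩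

lemma Conf.symm {e f : E} (h : Conf d e f) : Conf d f e := by
  obtain ⟨h, x, hx, y, hy, hxy⟩ := h
  exact ⟨h.symm, y, hy, x, hx, hxy.symm⟩

lemma conf_of_mem {e f : E} {x : V} (hne : e ≠ f) (he : x ∈ d e) (hf : x ∈ d f) : Conf d e f :=
  ⟨hne, x, he, x, hf, e, he, he⟩

lemma ProperOn.mono {L : E → Finset γ} {c : E → γ} {W W' : Finset E} (h : ProperOn d L c W)
    (hW : W' ⊆ W) : ProperOn d L c W' :=
  ⟨fun e he => h.1 e (hW he), fun e he f hf => h.2 e (hW he) f (hW hf)⟩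

/-- Coloring one more edge. -/
lemma ProperOn.update {L : E → Finset γ} {c : E → γ} {W : Finset E} (h : ProperOn d L c W)
    {a : E} (ha : a ∉ W) {t : γ} (ht : t ∈ L a) (hc : ∀ f ∈ W, Conf d a f → c f ≠ t) :
    ProperOn d L (Function.update c a t) (insert a W) := by
  have hne : ∀ e ∈ W, e ≠ a := fun e he h' => ha (h' ▸ he)
  constructor
  · intro e he
    rcases Finset.mem_insert.1 he with rfl | he
    · simpa using ht
    · rw [Function.update_of_ne (hne e he)]; exact h.1 e he
  · intro e he f hf hef
    rcases Finset.mem_insert.1 he with he1 | he1 <;> rcases Finset.mem_insert.1 hf with hf1 | hf1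
    · exact absurd (he1.trans hf1.symm) hef.1
    · rw [he1, Function.update_self, Function.update_of_ne (hne f hf1)]
      exact (hc f hf1 (he1 ▸ hef)).symm
    · rw [hf1, Function.update_self, Function.update_of_ne (hne e he1)]
      exact hc e he1 (hf1 ▸ hef.symm)
    · rw [Function.update_of_ne (hne f hf1), Function.update_of_ne (hne e he1)]
      exact h.2 e he1 f hf1 hef

variable [Fintype E]

/-- The edges at the vertex `x` of the multigraph whose edges have the ends given by `d`. -/
noncomputable def inc (d : E → Sym2 V) (x : V) : Finset E := Finset.univ.filter (x ∈ d ·)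

/-- The edges in conflict with `e`. -/
noncomputable def confs (d : E → Sym2 V) (e : E) : Finset E := Finset.univ.filter (Conf d e)

@[simp] lemma mem_inc {x : V} {e : E} : e ∈ inc d x ↔ x ∈ d e := by simp [inc]

@[simp] lemma mem_confs {e f : E} : f ∈ confs d e ↔ Conf d e f := by simp [confs]

/-- Greedy coloring of the edges of `U` in order of decreasing keys. -/
theorem ProperOn.exists_greedy {L : E → Finset γ} {c : E → γ} {D : Finset E}
    (hc : ProperOn d L c D) (key : E → ℕ) (U : Finset E) (hDU : Disjoint D U)
    (h : ∀ e ∈ U, ((confs d e).filter (fun f => f ∈ D ∨ f ∈ U ∧ key e ≤ key f)).card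
      < (L e).card) :
    ∃ c', ProperOn d L c' (D ∪ U) ∧ ∀ e ∈ D, c' e = c e := by
  -- The inserted edge has the least key and is colored last, so every edge colored before it lies
  -- in `D` or has at least its key.
  induction U using Finset.induction_on_min_value key with
  | empty => exact ⟨c, by simpa using hc, fun _ _ => rfl⟩
  | insert a U ha hmin ih =>
    rw [Finset.disjoint_insert_right] at hDU
    obtain ⟨c', hc', hD⟩ := ih hDU.2 fun e he => by
      refine lt_of_le_of_lt (Finset.card_le_card ?_) (h e (Finset.mem_insert_of_mem he))
      intro f hf
      simp only [Finset.mem_filter, Finset.mem_insert] at hf ⊢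
      tauto
    have haW : a ∉ D ∪ U := by simp [ha, hDU.1]
    have hlt : (((confs d a).filter (· ∈ D ∪ U)).image c').card < (L a).card := by
      refine lt_of_le_of_lt (Finset.card_image_le.trans (Finset.card_le_card ?_))
        (h a (Finset.mem_insert_self a U))
      intro f hf
      simp only [Finset.mem_filter, Finset.mem_insert, Finset.mem_union] at hf ⊢
      refine ⟨hf.1, hf.2.imp id fun h' => ⟨Or.inr h', hmin f h'⟩⟩
    obtain ⟨t, ht, htn⟩ := Finset.exists_mem_notMem_of_card_lt_card hlt
    refine ⟨Function.update c' a t, ?_, fun e he => ?_⟩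
    · rw [Finset.union_insert]
      refine hc'.update haW ht fun f hf hf' heq => htn ?_
      exact Finset.mem_image.2 ⟨f, by simpa using ⟨hf', Finset.mem_union.1 hf⟩, heq⟩
    · have hea : e ≠ a := fun h' => hDU.1 (h' ▸ he)
      rw [Function.update_of_ne hea, hD e he]

/-- Hall's condition from the sizes of the sets. -/
lemma exists_injOn_of_card {ι : Type v} (Q : Finset ι) (R : ι → Finset γ)
    (h : ∀ J ⊆ Q, J.Nonempty → ∃ q ∈ J, J.card ≤ (R q).card) :
    ∃ g : Q → γ, Function.Injective g ∧ ∀ q : Q, g q ∈ R q := by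
  refine (Finset.all_card_le_biUnion_card_iff_exists_injective fun q : Q => R q).1 fun J => ?_
  rcases J.eq_empty_or_nonempty with rfl | hJ
  · simp
  obtain ⟨q, hq, hqJ⟩ := h (J.map (Function.Embedding.subtype _))
    (fun x hx => by
      obtain ⟨y, -, rfl⟩ := Finset.mem_map.1 hx
      exact y.2) (by simpa using hJ)
  obtain ⟨y, hy, rfl⟩ := Finset.mem_map.1 hq
  rw [Finset.card_map] at hqJ
  exact hqJ.trans (Finset.card_le_card (Finset.subset_biUnion_of_mem (fun q : Q => R q) hy))

/-- Completing a coloring by a system of distinct representatives. -/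
theorem ProperOn.exists_complete {L : E → Finset γ} {c : E → γ} {Q : Finset E}
    (hc : ProperOn d L c Qᶜ)
    (h : ∀ J ⊆ Q, J.Nonempty → ∃ q ∈ J, J.card ≤ (L q \ (confs d q \ Q).image c).card) :
    ∃ c', ProperOn d L c' Finset.univ := by
  obtain ⟨g, hg, hgR⟩ := exists_injOn_of_card Q _ h
  refine ⟨fun e => if he : e ∈ Q then g ⟨e, he⟩ else c e, fun e _ => ?_, fun e _ f _ hef => ?_⟩
  · by_cases he : e ∈ Q
    · simpa [he] using (Finset.mem_sdiff.1 (hgR ⟨e, he⟩)).1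
    · simpa [he] using hc.1 e (by simpa using he)
  · have key : ∀ e f, Conf d e f → ∀ he : e ∈ Q, f ∉ Q → g ⟨e, he⟩ ≠ c f := by
      intro e f hef he hf heq
      refine (Finset.mem_sdiff.1 (hgR ⟨e, he⟩)).2 (Finset.mem_image.2 ⟨f, ?_, heq.symm⟩)
      simpa using ⟨hef, hf⟩
    by_cases he : e ∈ Q <;> by_cases hf : f ∈ Q <;> simp only [he, hf, dite_true, dite_false]
    · intro heq
      exact hef.1 (congrArg Subtype.val (hg heq))
    · exact key e f hef he hf
    · exact (key f e hef.symm hf he).symm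
    · exact hc.2 e (by simpa using he) f (by simpa using hf) hef

end EndsMap

/-! ### Bounds on the number of conflicts of an edge. -/

namespace EndsMap

open scoped Classical

variable {V : Type u} {E : Type v} {γ : Type w} {d : E → Sym2 V}

/-- The other end of the edge `f` at `x`. -/
noncomputable def oth (d : E → Sym2 V) (x : V) (f : E) : V :=
  if h : x ∈ d f then Sym2.Mem.other h else x

lemma ends_eq_oth {x : V} {f : E} (h : x ∈ d f) : d f = s(x, oth d x f) := by
  rw [oth, dif_pos h, Sym2.other_spec]

lemma oth_eq {x y : V} {f : E} (h : d f = s(x, y)) : oth d x f = y := by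
  have h1 := ends_eq_oth (d := d) (x := x) (f := f) (by rw [h]; exact Sym2.mem_mk_left x y)
  rw [h] at h1
  exact (Sym2.congr_right.1 h1).symm

variable [Fintype E]

/-- Multigraphs of maximum degree at most four: every vertex is on at most four edges, and on at
most three if it carries a loop. -/
structure MaxFour (d : E → Sym2 V) : Prop where
  card_le : ∀ x, (inc d x).card ≤ 4
  card_loop : ∀ x e, d e = s(x, x) → (inc d x).card ≤ 3

/-- The other ends of the edges at `x` different from `e`. -/
noncomputable def side (d : E → Sym2 V) (e : E) (x : V) : Finset V :=
  ((inc d x).erase e).image (oth d x)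

lemma mem_side {e f : E} {x z : V} (hf : d f = s(x, z)) (hne : f ≠ e) : z ∈ side d e x :=
  Finset.mem_image.2 ⟨f, by simp [hf, hne], oth_eq hf⟩

lemma card_side_lt {e : E} {x : V} (hx : x ∈ d e) : (side d e x).card < (inc d x).card :=
  lt_of_le_of_lt Finset.card_image_le (Finset.card_erase_lt_of_mem (by simpa using hx))

/-- If `f` shares an end with `e`, its other end is in a side of `e`; if `f` is joined to `e` by an
edge `g ≠ e`, the far end of `g` is. A joining edge equal to `e` falls under the first case. -/
lemma confs_subset {e : E} {x y : V} (he : d e = s(x, y)) :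
    confs d e ⊆ ((side d e x ∪ side d e y).biUnion (inc d)).erase e := by
  intro f hf
  rw [mem_confs] at hf
  obtain ⟨hne, a, ha, z, hz, g, hag, hzg⟩ := hf
  have hside : ∀ a ∈ d e, side d e a ⊆ side d e x ∪ side d e y := by
    intro a ha
    rw [he, Sym2.mem_iff] at ha
    rcases ha with rfl | rfl
    · exact Finset.subset_union_left
    · exact Finset.subset_union_right
  have hinc : ∀ a ∈ d e, a ∈ d f → f ∈ (side d e x ∪ side d e y).biUnion (inc d) := by
    intro a ha haf
    have h1 := ends_eq_oth haf
    refine Finset.mem_biUnion.2 ⟨oth d a f, hside a ha (mem_side h1 hne.symm), ?_⟩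
    rw [mem_inc, h1]
    exact Sym2.mem_mk_right _ _
  refine Finset.mem_erase.2 ⟨hne.symm, ?_⟩
  by_cases hge : g = e
  · exact hinc z (hge ▸ hzg) hz
  have h1 := ends_eq_oth hag
  rw [h1, Sym2.mem_iff] at hzg
  rcases hzg with rfl | hzg
  · exact hinc z ha hz
  · exact Finset.mem_biUnion.2 ⟨oth d a g, hside a ha (mem_side h1 hge), by simpa [← hzg] using hz⟩

lemma card_biUnion_inc_le (hd : MaxFour d) (M : Finset V) :
    (M.biUnion (inc d)).card ≤ 4 * M.card := by
  rw [mul_comm]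
  exact Finset.card_biUnion_le_card_mul _ _ _ fun x _ => hd.card_le x

lemma card_side_union_le (hd : MaxFour d) {e : E} {x y : V} (he : d e = s(x, y)) :
    (side d e x ∪ side d e y).card ≤ 6 := by
  have h1 := card_side_lt (d := d) (e := e) (x := x) (by simp [he])
  have h2 := card_side_lt (d := d) (e := e) (x := y) (by simp [he])
  have h3 := hd.card_le x
  have h4 := hd.card_le y
  have := Finset.card_union_le (side d e x) (side d e y)
  omega

/-- At most twenty edges in conflict with `e` avoid a given neighbor of an end of `e`. -/
lemma card_confs_sdiff_le (hd : MaxFour d) {e f : E} {x y z : V} (he : d e = s(x, y))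
    (hf : d f = s(x, z)) (hne : f ≠ e) : (confs d e \ inc d z).card ≤ 20 := by
  have hz : z ∈ side d e x ∪ side d e y := Finset.mem_union_left _ (mem_side hf hne)
  have hsub : confs d e \ inc d z ⊆ ((side d e x ∪ side d e y).erase z).biUnion (inc d) := by
    intro g hg
    rw [Finset.mem_sdiff] at hg
    obtain ⟨t, ht, htg⟩ := Finset.mem_biUnion.1 (Finset.mem_of_mem_erase (confs_subset he hg.1))
    exact Finset.mem_biUnion.2 ⟨t, Finset.mem_erase.2 ⟨fun h => hg.2 (h ▸ htg), ht⟩, htg⟩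
  have h1 := Finset.card_le_card hsub
  have h2 := card_biUnion_inc_le hd ((side d e x ∪ side d e y).erase z)
  have h3 := Finset.card_erase_of_mem hz
  have h4 := card_side_union_le hd he
  omega

/-- Edges with both ends in `M` are counted twice among the edges at the vertices of `M`. -/
lemma card_biUnion_inc_add_le (hd : MaxFour d) (M : Finset V) (F : Finset E)
    (hF : ∀ f ∈ F, ∃ x ∈ M, ∃ y ∈ M, x ≠ y ∧ d f = s(x, y)) :
    (M.biUnion (inc d)).card + F.card ≤ 4 * M.card := by
  have h1 : ∑ x ∈ M, (inc d x).card ≤ 4 * M.card := by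
    rw [mul_comm]
    exact Finset.sum_le_card_nsmul _ _ _ fun x _ => hd.card_le x
  have h2 : ∑ x ∈ M, (inc d x).card = ∑ f : E, (M.filter (· ∈ d f)).card := by
    simp only [inc, Finset.card_filter]
    exact Finset.sum_comm
  refine le_trans ?_ (h2 ▸ h1)
  have h3 : ∀ W : Finset E, W.card = ∑ f : E, if f ∈ W then 1 else 0 := fun W => by simp
  rw [h3, h3 F, ← Finset.sum_add_distrib]
  refine Finset.sum_le_sum fun f _ => ?_
  by_cases hfF : f ∈ F
  · obtain ⟨x, hx, y, hy, hxy, hf⟩ := hF f hfF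
    have : 1 < (M.filter (· ∈ d f)).card :=
      Finset.one_lt_card.2 ⟨x, by simp [hx, hf], y, by simp [hy, hf], hxy⟩
    split_ifs <;> omega
  · rw [if_neg hfF]
    split_ifs with hfM
    · obtain ⟨x, hx, hxf⟩ := Finset.mem_biUnion.1 hfM
      exact Finset.card_pos.2 ⟨x, by simpa [hx] using hxf⟩
    · omega

/-- Six vertices on four edges each give 24, and every edge between two of these vertices is counted
twice. -/
lemma card_confs_add_le (hd : MaxFour d) {e : E} {x y : V} (he : d e = s(x, y)) (F : Finset E)
    (hF : ∀ f ∈ F, ∃ a ∈ side d e x ∪ side d e y, ∃ b ∈ side d e x ∪ side d e y,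
      a ≠ b ∧ d f = s(a, b)) : (confs d e).card + F.card ≤ 24 := by
  have h1 := Finset.card_le_card ((confs_subset he).trans (Finset.erase_subset _ _))
  have h2 := card_biUnion_inc_add_le hd _ F hF
  have h3 := card_side_union_le hd he
  omega

lemma card_confs_le (hd : MaxFour d) (e : E) : (confs d e).card ≤ 24 := by
  obtain ⟨x, y, he⟩ : ∃ x y, d e = s(x, y) := by
    induction h : d e with
    | _ x y => exact ⟨x, y, rfl⟩
  exact card_confs_add_le hd he ∅ (by simp)

lemma card_confs_le_of_card_side (hd : MaxFour d) {e : E} {x y : V} (he : d e = s(x, y))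
    (h : (side d e x ∪ side d e y).card ≤ 5) : (confs d e).card ≤ 20 := by
  have h1 := Finset.card_le_card ((confs_subset he).trans (Finset.erase_subset _ _))
  have h2 := card_biUnion_inc_le hd (side d e x ∪ side d e y)
  omega

/-- Edges at a vertex on at most three edges. -/
lemma card_confs_le_of_card_inc (hd : MaxFour d) {e : E} {x : V} (he : x ∈ d e)
    (hx : (inc d x).card ≤ 3) : (confs d e).card ≤ 20 := by
  have h1 := ends_eq_oth he
  refine card_confs_le_of_card_side hd h1 ?_
  have h2 := card_side_lt he
  have h3 := card_side_lt (d := d) (e := e) (x := oth d x e) (by rw [h1]; simp)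
  have h4 := hd.card_le (oth d x e)
  have := Finset.card_union_le (side d e x) (side d e (oth d x e))
  omega

/-- Edges in a pair of parallel edges. -/
lemma card_confs_le_of_parallel (hd : MaxFour d) {e f : E} {x y : V} (hxy : x ≠ y)
    (he : d e = s(x, y)) (hf : d f = s(x, y)) (hne : f ≠ e) : (confs d e).card ≤ 21 := by
  have hy : y ∈ side d e x ∪ side d e y := Finset.mem_union_left _ (mem_side hf hne)
  have hx : x ∈ side d e x ∪ side d e y :=
    Finset.mem_union_right _ (mem_side (hf.trans Sym2.eq_swap) hne)
  -- Now `x` and `y` themselves are in the sides, so `e` and `f` are counted twice, and `e` is no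
  -- conflict of itself: `24 - 2 - 1 = 21`.
  have h1 := card_biUnion_inc_add_le hd (side d e x ∪ side d e y) {e, f} (by
    intro g hg
    refine ⟨x, hx, y, hy, hxy, ?_⟩
    rcases Finset.mem_insert.1 hg with rfl | hg
    · exact he
    · rw [Finset.mem_singleton.1 hg, hf])
  have h2 := Finset.card_le_card (confs_subset he)
  have h3 : e ∈ (side d e x ∪ side d e y).biUnion (inc d) :=
    Finset.mem_biUnion.2 ⟨x, hx, by simp [he]⟩
  rw [Finset.card_erase_of_mem h3] at h2
  rw [Finset.card_pair hne.symm] at h1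
  have h4 := card_side_union_le hd he
  omega

/-- Edges at an end of a pair of parallel edges. -/
lemma card_confs_le_of_parallel_at (hd : MaxFour d) {e f g : E} {x y : V} (he : x ∈ d e)
    (hf : d f = s(x, y)) (hg : d g = s(x, y)) (hfg : f ≠ g) (hef : e ≠ f) (heg : e ≠ g) :
    (confs d e).card ≤ 20 := by
  have h1 := ends_eq_oth he
  refine card_confs_le_of_card_side hd h1 ?_
  -- The edges `f` and `g` have the same other end, so `f` can be dropped when forming the side.
  have h2 : (side d e x).card ≤ 2 := by
    have h5 : side d e x ⊆ ((((inc d x).erase e).erase f)).image (oth d x) := by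
      intro z hz
      obtain ⟨k, hk, rfl⟩ := Finset.mem_image.1 hz
      by_cases hkf : k = f
      · refine Finset.mem_image.2 ⟨g, by simp [hfg.symm, heg.symm, hg], ?_⟩
        rw [hkf, oth_eq hf, oth_eq hg]
      · exact Finset.mem_image.2 ⟨k, Finset.mem_erase.2 ⟨hkf, hk⟩, rfl⟩
    have h6 := (Finset.card_le_card h5).trans Finset.card_image_le
    rw [Finset.card_erase_of_mem (by simp [hef.symm, hf]),
      Finset.card_erase_of_mem (by simpa using he)] at h6
    have := hd.card_le x
    omega
  have h3 := card_side_lt (d := d) (e := e) (x := oth d x e) (by rw [h1]; simp)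
  have h4 := hd.card_le (oth d x e)
  have := Finset.card_union_le (side d e x) (side d e (oth d x e))
  omega

/-- Edges in a triangle. -/
lemma card_confs_le_of_triangle (hd : MaxFour d) {e f g : E} {x y z : V} (he : d e = s(x, y))
    (hf : d f = s(x, z)) (hg : d g = s(y, z)) (hfe : f ≠ e) (hge : g ≠ e) :
    (confs d e).card ≤ 20 := by
  refine card_confs_le_of_card_side hd he ?_
  have h1 := card_side_lt (d := d) (e := e) (x := x) (by simp [he])
  have h2 := card_side_lt (d := d) (e := e) (x := y) (by simp [he])
  have h3 := hd.card_le x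
  have h4 := hd.card_le y
  have h5 := Finset.card_union_add_card_inter (side d e x) (side d e y)
  have h6 : 0 < (side d e x ∩ side d e y).card :=
    Finset.card_pos.2 ⟨z, Finset.mem_inter.2 ⟨mem_side hf hfe, mem_side hg hge⟩⟩
  omega

end EndsMap

/-! ### Components and coloring towards a root. -/

namespace EndsMap

open scoped Classical

variable {V : Type u} {E : Type v} {γ : Type w} {d : E → Sym2 V}

/-- The underlying simple graph. -/
def simple (d : E → Sym2 V) : SimpleGraph V := SimpleGraph.fromRel (Near d)

lemma simple_adj {x y : V} : (simple d).Adj x y ↔ x ≠ y ∧ Near d x y := by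
  rw [simple, SimpleGraph.fromRel_adj]
  exact and_congr_right fun _ => ⟨fun h => h.elim id Near.symm, Or.inl⟩

lemma exists_edge {x y : V} (h : (simple d).Adj x y) : ∃ e, d e = s(x, y) := by
  obtain ⟨hne, e, hx, hy⟩ := simple_adj.1 h
  exact ⟨e, (Sym2.mem_and_mem_iff hne).1 ⟨hx, hy⟩⟩

lemma Near.eq_or_adj {x y : V} (h : Near d x y) : x = y ∨ (simple d).Adj x y := by
  by_cases hxy : x = y
  · exact Or.inl hxy
  · exact Or.inr (simple_adj.2 ⟨hxy, h⟩)

lemma Near.reachable {x y : V} (h : Near d x y) : (simple d).Reachable x y := by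
  by_cases hxy : x = y
  · rw [hxy]
  · exact (simple_adj.2 ⟨hxy, h⟩).reachable

lemma exists_ends (d : E → Sym2 V) (e : E) : ∃ x y, d e = s(x, y) := by
  induction h : d e with
  | _ x y => exact ⟨x, y, rfl⟩

/-- A vertex reachable from `s` and different from `s` has a neighbor closer to `s`. -/
lemma exists_closer {s x : V} (h : (simple d).Reachable s x) (hne : x ≠ s) :
    ∃ z f, d f = s(x, z) ∧ (simple d).Reachable s z ∧
      (simple d).dist s z < (simple d).dist s x := by
  obtain ⟨p, hp⟩ := h.symm.exists_walk_length_eq_dist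
  cases p with
  | nil => exact absurd rfl hne
  | @cons _ z _ hadj q =>
    obtain ⟨hxz, f, hx, hz⟩ := simple_adj.1 hadj
    refine ⟨z, f, (Sym2.mem_and_mem_iff hxz).1 ⟨hx, hz⟩, q.reachable.symm, ?_⟩
    rw [SimpleGraph.dist_comm, SimpleGraph.dist_comm (u := s), ← hp]
    exact Nat.lt_succ_of_le (SimpleGraph.dist_le q)

variable [Fintype E]

/-- The edges outside the component of `s`. -/
noncomputable def away (d : E → Sym2 V) (s : V) : Finset E :=
  Finset.univ.filter fun e => ∀ x ∈ d e, ¬ (simple d).Reachable s x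

lemma mem_away {s : V} {e : E} : e ∈ away d s ↔ ∀ x ∈ d e, ¬ (simple d).Reachable s x := by
  simp [away]

/-- No conflict leaves a component, so a coloring outside the component of `s` combines freely with
any coloring inside. -/
lemma not_reachable_of_conf {s : V} {e f : E} (he : e ∈ away d s) (h : Conf d e f) :
    f ∈ away d s := by
  obtain ⟨-, x, hx, y, hy, hxy⟩ := h
  rw [mem_away] at he ⊢
  intro z hz hsz
  have h1 : Near d y z := ⟨f, hy, hz⟩
  exact he x hx ((hsz.trans h1.reachable.symm).trans hxy.reachable.symm)

/-- A coloring of a matching `P` extends to all edges outside a set `Q` of edges at `S`, if the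
edges outside the component of `s` are colorable and the edges at `S` have few conflicts. -/
theorem exists_properOn_compl (hd : MaxFour d) {L : E → Finset γ} (hL : ∀ e, (L e).card = 22)
    {s : V} {S : Set V} (hsS : s ∈ S) (hS : ∀ x ∈ S, (simple d).Reachable s x) {P Q : Finset E}
    {c₀ : E → γ} (hP : ProperOn d L c₀ P)
    (hPm : ∀ e ∈ P, ∀ f ∈ P, ∀ x, x ∈ d e → x ∈ d f → e = f)
    (hPs : ∀ e ∈ P, e ∉ away d s) (hPQ : Disjoint P Q) (hQ : ∀ e ∈ Q, ∃ x ∈ S, x ∈ d e)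
    (hR : ∀ x ∈ S, ∀ e, x ∈ d e → e ∉ P → e ∉ Q → (confs d e \ Q).card ≤ 21)
    (ih : ∃ c, ProperOn d L c (away d s)) :
    ∃ c, ProperOn d L c Qᶜ ∧ ∀ e ∈ P, c e = c₀ e := by
  obtain ⟨c₁, hc₁⟩ := ih
  have hQs : ∀ e ∈ Q, e ∉ away d s := fun e he h => by
    obtain ⟨x, hx, hxe⟩ := hQ e he
    exact mem_away.1 h x hxe (hS x hx)
  have hD : ProperOn d L (fun e => if e ∈ P then c₀ e else c₁ e) (away d s ∪ P) := by
    have hne : ∀ e ∈ away d s, e ∉ P := fun e he h => hPs e h he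
    constructor
    · intro e he
      by_cases heP : e ∈ P
      · simpa [heP] using hP.1 e heP
      · simpa [heP] using hc₁.1 e ((Finset.mem_union.1 he).resolve_right heP)
    · intro e he f hf hef
      by_cases heP : e ∈ P
      · by_cases hfP : f ∈ P
        · simpa [heP, hfP] using hP.2 e heP f hfP hef
        · exact absurd (not_reachable_of_conf ((Finset.mem_union.1 hf).resolve_right hfP) hef.symm)
            (hPs e heP)
      · have he' := (Finset.mem_union.1 he).resolve_right heP
        have hf' := not_reachable_of_conf he' hef
        simpa [heP, hne f hf'] using hc₁.2 e he' f hf' hef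
  -- The key of an edge is the smaller height of its ends; the height vanishes exactly on `S`, so
  -- edges at `S` come last.
  set h : V → ℕ := fun x => if x ∈ S then 0 else (simple d).dist s x + 1 with hh
  set key : E → ℕ := fun e =>
    Sym2.lift ⟨fun x y => min (h x) (h y), fun x y => min_comm _ _⟩ (d e) with hkey
  have hkey' : ∀ e x y, d e = s(x, y) → key e = min (h x) (h y) := fun e x y he => by
    simp [hkey, he]
  have hkey_le : ∀ e x, x ∈ d e → key e ≤ h x := fun e x he => by
    rw [hkey' e x _ (ends_eq_oth he)]
    exact min_le_left _ _
  set U : Finset E := (away d s ∪ P ∪ Q)ᶜ with hU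
  have hDQ : ∀ e ∈ away d s ∪ P, e ∉ Q := fun e he heQ =>
    (Finset.mem_union.1 he).elim (fun h => hQs e heQ h)
      (fun h => Finset.disjoint_left.1 hPQ h heQ)
  obtain ⟨c, hc, hcD⟩ := hD.exists_greedy key U (by
    rw [Finset.disjoint_left]
    intro e he heU
    exact Finset.mem_compl.1 heU (Finset.mem_union_left _ he)) (by
    intro e heU
    rw [hL e]
    have heU' : e ∉ away d s ∧ e ∉ P ∧ e ∉ Q := by simpa [hU, not_or, and_assoc] using heU
    obtain ⟨hea, heP, heQ⟩ := heU'
    by_cases heS : ∃ x ∈ S, x ∈ d e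
    · obtain ⟨x, hx, hxe⟩ := heS
      refine Nat.lt_succ_of_le ((Finset.card_le_card fun f hf => ?_).trans (hR x hx e hxe heP heQ))
      rw [Finset.mem_filter] at hf
      refine Finset.mem_sdiff.2 ⟨hf.1, ?_⟩
      rcases hf.2 with h1 | h1
      · exact hDQ f h1
      · intro h2
        exact Finset.mem_compl.1 h1.1 (Finset.mem_union_right _ h2)
    · push Not at heS
      obtain ⟨x, y, he, hxy⟩ : ∃ x y, d e = s(x, y) ∧ h x ≤ h y := by
        obtain ⟨x, y, he⟩ := exists_ends d e
        rcases le_total (h x) (h y) with h1 | h1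
        · exact ⟨x, y, he, h1⟩
        · exact ⟨y, x, he.trans Sym2.eq_swap, h1⟩
      have hxe : x ∈ d e := by simp [he]
      have hxS : x ∉ S := fun h1 => heS x h1 hxe
      have hxs : (simple d).Reachable s x := by
        rw [mem_away] at hea
        push Not at hea
        obtain ⟨z, hz, hsz⟩ := hea
        exact hsz.trans (Near.reachable ⟨e, hz, hxe⟩)
      obtain ⟨z, f, hf, hsz, hlt⟩ := exists_closer hxs (fun h1 => hxS (h1 ▸ hsS))
      have hzx : h z < h x := by
        simp only [hh, hxS, if_false]
        split_ifs <;> omega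
      have hfe : f ≠ e := by
        rintro rfl
        rw [he] at hf
        rw [Sym2.congr_right.1 hf] at hxy
        omega
      -- The edges at `z` have smaller keys than `e`. Before `e`, only an edge of `P` can be colored
      -- among them, and there is at most one: `20 + 1 < 22`.
      have h1 := card_confs_sdiff_le hd he hf hfe
      have h2 : (P.filter (z ∈ d ·)).card ≤ 1 := by
        rw [Finset.card_le_one]
        intro a ha b hb
        rw [Finset.mem_filter] at ha hb
        exact hPm a ha.1 b hb.1 z ha.2 hb.2
      refine lt_of_le_of_lt (Finset.card_le_card (t := (confs d e \ inc d z) ∪ P.filter (z ∈ d ·))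
        ?_) (lt_of_le_of_lt (Finset.card_union_le _ _) (by omega))
      intro g hg
      rw [Finset.mem_filter] at hg
      by_cases hzg : z ∈ d g
      · refine Finset.mem_union_right _ (Finset.mem_filter.2 ⟨?_, hzg⟩)
        rcases hg.2 with h3 | h3
        · exact (Finset.mem_union.1 h3).resolve_left fun h4 => mem_away.1 h4 z hzg hsz
        · have := hkey_le g z hzg
          have := hkey' e x y he
          rw [min_eq_left hxy] at this
          omega
      · exact Finset.mem_union_left _ (Finset.mem_sdiff.2 ⟨hg.1, by simpa using hzg⟩))
  refine ⟨c, hc.mono fun e he => ?_, fun e he => ?_⟩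
  · by_cases he' : e ∈ away d s ∪ P
    · exact Finset.mem_union_left _ he'
    · refine Finset.mem_union_right _ (Finset.mem_compl.2 fun h1 => ?_)
      exact (Finset.mem_union.1 h1).elim he' (Finset.mem_compl.1 he)
  · rw [hcD e (Finset.mem_union_right _ he), if_pos he]

/-- Induction over components. -/
theorem exists_properOn_univ_of_step
    (step : ∀ (E : Type v) [Fintype E] (d : E → Sym2 V) (L : E → Finset γ), MaxFour d →
      (∀ e, (L e).card = 22) → (∀ s e, s ∈ d e → ∃ c, ProperOn d L c (away d s)) →
      ∃ c, ProperOn d L c Finset.univ)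
    (n : ℕ) : ∀ (E : Type v) [Fintype E] (d : E → Sym2 V) (L : E → Finset γ), MaxFour d →
      (∀ e, (L e).card = 22) → Fintype.card E = n → ∃ c, ProperOn d L c Finset.univ := by
  induction n using Nat.strong_induction_on with
  | _ n ih =>
    intro E _ d L hd hL hn
    refine step E d L hd hL fun s e hse => ?_
    have hinc : ∀ x, (inc (fun f : away d s => d f) x).card ≤ (inc d x).card := fun x => by
      rw [← Finset.card_map (Function.Embedding.subtype _)]
      refine Finset.card_le_card fun f hf => ?_
      obtain ⟨g, hg, rfl⟩ := Finset.mem_map.1 hf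
      simpa using hg
    obtain ⟨c, hc⟩ := ih (Fintype.card (away d s)) (by
      rw [← hn, Fintype.card_coe, ← Finset.card_univ]
      refine Finset.card_lt_card ⟨Finset.subset_univ _, fun h => ?_⟩
      exact mem_away.1 (h (Finset.mem_univ e)) s hse (SimpleGraph.Reachable.refl s))
      (away d s) (fun f => d f) (fun f => L f)
      ⟨fun x => (hinc x).trans (hd.card_le x), fun x f hf => (hinc x).trans (hd.card_loop x f hf)⟩
      (fun f => hL f) rfl
    have hne : ∀ f, (L f).Nonempty := fun f => Finset.card_pos.1 (by rw [hL f]; norm_num)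
    refine ⟨fun f => if hf : f ∈ away d s then c ⟨f, hf⟩ else (hne f).choose, fun f hf => ?_,
      fun f hf g hg hfg => ?_⟩
    · simpa [hf] using hc.1 ⟨f, hf⟩ (Finset.mem_univ _)
    · simp only [hf, hg, dite_true]
      refine hc.2 ⟨f, hf⟩ (Finset.mem_univ _) ⟨g, hg⟩ (Finset.mem_univ _) ?_
      obtain ⟨hne, x, hx, y, hy, k, hxk, hyk⟩ := hfg
      refine ⟨fun h => hne (congrArg Subtype.val h), x, hx, y, hy, ⟨k, ?_⟩, hxk, hyk⟩
      -- The edge witnessing the conflict also lies outside the component, so the conflict persists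
      -- in the restricted multigraph.
      by_cases hfk : f = k
      · exact hfk ▸ hf
      · exact not_reachable_of_conf hf (conf_of_mem hfk hx hxk)

end EndsMap

/-! ### Choosing colors that four given lists seldom use. -/

namespace EndsMap

open scoped Classical

variable {ι : Type v} {γ : Type w}

/-- The number of lists `A q`, `q ∈ Q`, that contain the color `c`. -/
noncomputable def mult (Q : Finset ι) (A : ι → Finset γ) (c : γ) : ℕ :=
  (Q.filter fun q => c ∈ A q).card

/-- Double counting: the total use of a palette by the lists is computed color by color. -/
lemma sum_card_inter (Q : Finset ι) (A : ι → Finset γ) (C : Finset γ) :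
    ∑ q ∈ Q, (A q ∩ C).card = ∑ c ∈ C, mult Q A c := by
  have h : ∀ q, (A q ∩ C).card = ∑ c ∈ C, if c ∈ A q then 1 else 0 := fun q => by
    rw [← Finset.card_filter, Finset.inter_comm, Finset.filter_mem_eq_inter]
  simp only [h, mult, Finset.card_filter]
  exact Finset.sum_comm

lemma mult_le (Q : Finset ι) (A : ι → Finset γ) (c : γ) : mult Q A c ≤ Q.card :=
  Finset.card_filter_le _ _

/-- Two lists have representatives that are, in total, rarely used by four lists. -/
theorem exists_pair {Q : Finset ι} {A : ι → Finset γ} (hQ : Q.card = 4)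
    (hA : ∀ q ∈ Q, (A q).card = 22) {B B' : Finset γ} (hB : 20 ≤ B.card) (hB' : 20 ≤ B'.card) :
    ∃ b ∈ B, ∃ b' ∈ B', ∑ q ∈ Q, (A q ∩ {b, b'}).card ≤ 4 := by
  by_cases hdis : Disjoint B B'
  · obtain ⟨b, hb, hbmin⟩ := B.exists_min_image (mult Q A) (Finset.card_pos.1 (by omega))
    obtain ⟨b', hb', hbmin'⟩ := B'.exists_min_image (mult Q A) (Finset.card_pos.1 (by omega))
    refine ⟨b, hb, b', hb', ?_⟩
    have h1 := Finset.card_nsmul_le_sum B (mult Q A) _ hbmin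
    have h2 := Finset.card_nsmul_le_sum B' (mult Q A) _ hbmin'
    -- With minimal multiplicities `m` and `m'`, disjointness gives `20 * (m + m') ≤ 4 * 22 = 88`,
    -- hence `m + m' ≤ 4`.
    have h3 : ∑ q ∈ Q, (A q ∩ (B ∪ B')).card ≤ Q.card • 22 :=
      Finset.sum_le_card_nsmul _ _ _ fun q hq =>
        (Finset.card_le_card Finset.inter_subset_left).trans (hA q hq).le
    rw [sum_card_inter, Finset.sum_union hdis, hQ] at h3
    have hne : b ≠ b' := fun h => Finset.disjoint_left.1 hdis hb (h ▸ hb')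
    rw [sum_card_inter, Finset.sum_pair hne]
    simp only [smul_eq_mul] at h1 h2 h3
    nlinarith
  · obtain ⟨b, hb, hb'⟩ := Finset.not_disjoint_iff.1 hdis
    refine ⟨b, hb, b, hb', ?_⟩
    rw [sum_card_inter, Finset.pair_eq_singleton, Finset.sum_singleton, ← hQ]
    exact mult_le Q A b

/-- Four lists have representatives that are, in total, not used often by four lists of the same
size. -/
theorem exists_quadruple {Q : Finset ι} {A : ι → Finset γ} (hQ : Q.card = 4)
    (hA : ∀ q ∈ Q, (A q).card = 22) {B : Fin 4 → Finset γ} (hB : ∀ i, (B i).card = 22) :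
    ∃ c : Fin 4 → γ, (∀ i, c i ∈ B i) ∧
      ∑ q ∈ Q, (A q ∩ Finset.univ.image c).card ≤ 7 := by
  have hm4 : ∀ c, mult Q A c ≤ 4 := fun c => hQ ▸ mult_le Q A c
  have hsum : ∀ c : Fin 4 → γ,
      ∑ q ∈ Q, (A q ∩ Finset.univ.image c).card ≤ ∑ i, mult Q A (c i) := fun c => by
    rw [sum_card_inter]
    exact Finset.sum_image_le_of_nonneg (fun _ _ => Nat.zero_le _)
  by_cases hthree : ∃ c k, ∀ i, i ≠ k → c ∈ B i
  · obtain ⟨c, k, hc⟩ := hthree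
    by_cases hk : ∃ b ∈ B k, mult Q A b ≤ 3
    · obtain ⟨b, hb, hb3⟩ := hk
      refine ⟨fun i => if i = k then b else c, fun i => ?_, ?_⟩
      · by_cases hi : i = k
        · simpa [hi] using hb
        · simpa [hi] using hc i hi
      · have hsub : Finset.univ.image (fun i => if i = k then b else c) ⊆ {b, c} := by
          intro x hx
          obtain ⟨i, -, rfl⟩ := Finset.mem_image.1 hx
          by_cases hi : i = k <;> simp [hi]
        rw [sum_card_inter]
        refine (Finset.sum_le_sum_of_subset hsub).trans ?_
        by_cases hbc : b = c
        · rw [hbc, Finset.pair_eq_singleton, Finset.sum_singleton]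
          exact (hm4 c).trans (by norm_num)
        · rw [Finset.sum_pair hbc]
          have := hm4 c
          omega
    · push Not at hk
      -- All colors of `B k` have multiplicity 4, so the lists `A q` all equal `B k`. Every `B i`
      -- has either the fixed color `a` of `B k` or a color outside `B k`, so each `A q` meets the
      -- palette at most in `a`.
      have hAB : ∀ q ∈ Q, A q = B k := fun q hq => by
        refine (Finset.eq_of_subset_of_card_le (fun b hb => ?_) (by rw [hA q hq, hB k])).symm
        have h1 : Q.filter (fun q => b ∈ A q) = Q :=
          Finset.eq_of_subset_of_card_le (Finset.filter_subset _ _)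
            (by have := hk b hb; rw [mult] at this; omega)
        exact (Finset.mem_filter.1 (h1.symm ▸ hq : q ∈ Q.filter (fun q => b ∈ A q))).2
      obtain ⟨a, ha⟩ : (B k).Nonempty := Finset.card_pos.1 (by rw [hB k]; norm_num)
      have hex : ∀ i, ∃ b ∈ B i, b ∈ B k → b = a := fun i => by
        by_cases hi : B i ⊆ B k
        · rw [Finset.eq_of_subset_of_card_le hi (by rw [hB, hB])]
          exact ⟨a, ha, fun _ => rfl⟩
        · obtain ⟨b, hb, hbk⟩ := Finset.not_subset.1 hi
          exact ⟨b, hb, fun h => absurd h hbk⟩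
      choose f hf hfa using hex
      refine ⟨f, hf, ?_⟩
      have h1 : ∑ q ∈ Q, (A q ∩ Finset.univ.image f).card ≤ Q.card • 1 := by
        refine Finset.sum_le_card_nsmul _ _ _ fun q hq => ?_
        have : Nonempty γ := ⟨a⟩
        rw [Finset.card_le_one_iff_subset_singleton]
        refine ⟨a, fun x hx => ?_⟩
        rw [Finset.mem_inter, hAB q hq, Finset.mem_image] at hx
        obtain ⟨hx, i, -, rfl⟩ := hx
        exact Finset.mem_singleton.2 (hfa i hx)
      rw [hQ] at h1
      exact h1.trans (by norm_num)
  · have htwo : ∀ c, (Finset.univ.filter fun i => c ∈ B i).card ≤ 2 := fun c => by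
      by_contra hc
      have h1 := Finset.card_filter_add_card_filter_not (s := Finset.univ) fun i : Fin 4 => c ∈ B i
      have h2 : (Finset.univ.filter fun i : Fin 4 => c ∉ B i).card ≤ 1 := by
        rw [Finset.card_univ, Fintype.card_fin] at h1
        omega
      refine hthree ⟨c, ?_⟩
      obtain ⟨k, hk⟩ := Finset.card_le_one_iff_subset_singleton.1 h2
      refine ⟨k, fun i hi => ?_⟩
      by_contra hci
      exact hi (Finset.mem_singleton.1 (hk (by simpa using hci)))
    have hmin : ∀ i, ∃ b ∈ B i, ∀ b' ∈ B i, mult Q A b ≤ mult Q A b' := fun i =>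
      (B i).exists_min_image (mult Q A) (Finset.card_pos.1 (by rw [hB i]; norm_num))
    choose f hf hfmin using hmin
    -- Since no color is in more than two of the `B i`, this sum is at most `4 * 22 * 2 = 176`. The
    -- minimal multiplicities in the four lists thus add up to at most `176 / 22 = 8`, one too many.
    have htot : ∑ i, ∑ b ∈ B i, mult Q A b = ∑ q ∈ Q, ∑ c ∈ A q,
        (Finset.univ.filter fun i => c ∈ B i).card := by
      simp only [← sum_card_inter]
      rw [Finset.sum_comm]
      refine Finset.sum_congr rfl fun q _ => ?_
      have := sum_card_inter Finset.univ B (A q)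
      simp only [mult] at this
      rw [← this]
      exact Finset.sum_congr rfl fun i _ => by rw [Finset.inter_comm]
    have hupper : ∑ i, ∑ b ∈ B i, mult Q A b ≤ 176 := by
      rw [htot]
      have h1 : ∀ q ∈ Q, ∑ c ∈ A q, (Finset.univ.filter fun i => c ∈ B i).card ≤ 44 := by
        intro q hq
        have := Finset.sum_le_card_nsmul (A q) _ 2 fun c _ => htwo c
        rw [hA q hq] at this
        exact this
      have := Finset.sum_le_card_nsmul Q _ 44 h1
      rw [hQ] at this
      exact this
    have hlow : ∀ i, 22 * mult Q A (f i) ≤ ∑ b ∈ B i, mult Q A b := fun i => by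
      have := Finset.card_nsmul_le_sum (B i) (mult Q A) _ (hfmin i)
      rwa [hB i, smul_eq_mul] at this
    by_cases h7 : ∑ i, mult Q A (f i) ≤ 7
    · exact ⟨f, hf, (hsum f).trans h7⟩
    push Not at h7
    -- If the minima add up to 8, all estimates are equalities, so any choice of representatives has
    -- the same multiplicities.
    have hconst : ∀ i, ∀ b ∈ B i, mult Q A b = mult Q A (f i) := by
      intro i b hb
      refine le_antisymm ?_ (hfmin i b hb)
      by_contra hlt
      push Not at hlt
      have h1 : 22 * mult Q A (f i) < ∑ b ∈ B i, mult Q A b := by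
        have := Finset.sum_lt_sum (f := fun _ => mult Q A (f i)) (hfmin i) ⟨b, hb, hlt⟩
        rwa [Finset.sum_const, hB i, smul_eq_mul] at this
      have h2 := Finset.sum_lt_sum (fun i _ => hlow i) ⟨i, Finset.mem_univ i, h1⟩
      rw [← Finset.mul_sum] at h2
      omega
    have h8 : ∑ i, mult Q A (f i) ≤ 8 := by
      have h2 := Finset.sum_le_sum fun i (_ : i ∈ Finset.univ) => hlow i
      rw [← Finset.mul_sum] at h2
      omega
    -- Otherwise the sum would be at most `4 * 22 = 88`, not 176.
    obtain ⟨q, hq, c, hcq, hc⟩ : ∃ q ∈ Q, ∃ c ∈ A q,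
        1 < (Finset.univ.filter fun i => c ∈ B i).card := by
      by_contra hno
      push Not at hno
      have h1 : ∀ q ∈ Q, ∑ c ∈ A q, (Finset.univ.filter fun i => c ∈ B i).card ≤ 22 := by
        intro q hq
        have := Finset.sum_le_card_nsmul (A q) _ 1 fun c hc => hno q hq c hc
        rw [hA q hq] at this
        exact this
      have h2 := Finset.sum_le_card_nsmul Q _ 22 h1
      rw [hQ, ← htot] at h2
      have h3 := Finset.sum_le_sum fun i (_ : i ∈ Finset.univ) => hlow i
      rw [← Finset.mul_sum] at h3
      simp only [smul_eq_mul] at h2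
      omega
    obtain ⟨i, hi, j, hj, hij⟩ := Finset.one_lt_card.1 hc
    simp only [Finset.mem_filter, Finset.mem_univ, true_and] at hi hj
    have hpos : 0 < mult Q A c := Finset.card_pos.2 ⟨q, by simpa [hq] using hcq⟩
    -- Using `c` for both `i` and `j` counts its positive multiplicity only once, which brings 8
    -- down to 7.
    set g : Fin 4 → γ := fun k => if k = i ∨ k = j then c else f k with hg
    have hgB : ∀ k, g k ∈ B k := fun k => by
      by_cases hk : k = i ∨ k = j
      · rw [hg]
        simp only [hk, if_true]
        rcases hk with rfl | rfl
        · exact hi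
        · exact hj
      · simpa [hg, hk] using hf k
    have hgm : ∀ k, mult Q A (g k) = mult Q A (f k) := fun k => hconst k _ (hgB k)
    have hsub : Finset.univ.image g ⊆ (Finset.univ.erase i).image g := by
      intro x hx
      obtain ⟨k, -, rfl⟩ := Finset.mem_image.1 hx
      by_cases hk : k = i
      · exact Finset.mem_image.2 ⟨j, by simpa using hij.symm, by simp [hg, hk]⟩
      · exact Finset.mem_image.2 ⟨k, by simpa using hk, rfl⟩
    refine ⟨g, hgB, ?_⟩
    rw [sum_card_inter]
    refine (Finset.sum_le_sum_of_subset hsub).trans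
      ((Finset.sum_image_le_of_nonneg (fun _ _ => Nat.zero_le _)).trans ?_)
    have h1 := Finset.add_sum_erase Finset.univ (fun k => mult Q A (f k)) (Finset.mem_univ i)
    have h2 : mult Q A (f i) = mult Q A c := (hconst i c hi).symm
    simp only [hgm]
    omega

end EndsMap

/-! ### Completing a coloring on four edges pairwise in conflict. -/

namespace EndsMap

open scoped Classical

variable {V : Type u} {E : Type v} {γ : Type w} {d : E → Sym2 V} [Fintype E]

lemma card_confs_sdiff_clique_le (hd : MaxFour d) {Q : Finset E} {e : E}
    (h : ∀ q ∈ Q, Conf d e q) : (confs d e \ Q).card + Q.card ≤ 24 := by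
  rw [Finset.card_sdiff_add_card_eq_card fun q hq => by simpa using h q hq]
  exact card_confs_le hd e

/-- A strong coloring exists if there is a clique `Q` of four edges with at most `D` conflicts each
and a matching `P` whose colors are rarely used by the lists of the edges in `Q`. -/
theorem exists_properOn_univ_of_clique (hd : MaxFour d) {L : E → Finset γ}
    (hL : ∀ e, (L e).card = 22)
    {s : V} {S : Set V} (hsS : s ∈ S) (hS : ∀ x ∈ S, (simple d).Reachable s x) {P Q : Finset E}
    {c₀ : E → γ} (hP : ProperOn d L c₀ P)
    (hPm : ∀ e ∈ P, ∀ f ∈ P, ∀ x, x ∈ d e → x ∈ d f → e = f)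
    (hPs : ∀ e ∈ P, e ∉ away d s) (hPQ : Disjoint P Q) (hQ : ∀ e ∈ Q, ∃ x ∈ S, x ∈ d e)
    (hR : ∀ x ∈ S, ∀ e, x ∈ d e → e ∉ Q → ∀ q ∈ Q, Conf d e q)
    (ih : ∃ c, ProperOn d L c (away d s))
    (hQ4 : Q.card = 4) (hQc : ∀ e ∈ Q, ∀ f ∈ Q, e ≠ f → Conf d e f)
    (hQP : ∀ e ∈ Q, ∀ f ∈ P, Conf d e f) {D β T : ℕ} (hD : ∀ e ∈ Q, (confs d e).card ≤ D)
    (hT : ∑ q ∈ Q, (L q ∩ P.image c₀).card ≤ T) (hβ : D + β ≤ 25 + P.card) (hPβ : P.card < β)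
    (hT2 : T + 2 < 2 * β) (hT3 : T + 6 < 3 * β) (hT4 : T + 12 < 4 * β) :
    ∃ c, ProperOn d L c Finset.univ := by
  obtain ⟨c, hc, hcP⟩ := exists_properOn_compl hd hL hsS hS hP hPm hPs hPQ hQ
    (fun x hx e he _ heQ => by
      have := card_confs_sdiff_clique_le hd (hR x hx e he heQ)
      omega) ih
  refine hc.exists_complete fun J hJ hJne => ?_
  by_contra hno
  push Not at hno
  have himg : P.image c = P.image c₀ := Finset.image_congr fun e he => hcP e he
  -- Three conflicts of `q` are in `Q` and `P.card` are in `P`. The other at most `D - 3 - P.card`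
  -- block one color each, while `P` blocks only its colors in `L q`; and `22 - (D - 3 - P.card) ≥
  -- β`.
  have hres : ∀ q ∈ Q, β ≤
      (L q \ (confs d q \ Q).image c).card + (L q ∩ P.image c₀).card := by
    intro q hq
    have h1 : (confs d q \ (Q.erase q ∪ P)).card + (3 + P.card) ≤ D := by
      have hdis : Disjoint (Q.erase q) P :=
        (hPQ.mono_right (Finset.erase_subset q Q)).symm
      have h2 : Q.erase q ∪ P ⊆ confs d q := by
        intro f hf
        rw [mem_confs]
        rcases Finset.mem_union.1 hf with hf | hf
        · exact hQc q hq f (Finset.mem_of_mem_erase hf) (Finset.ne_of_mem_erase hf).symm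
        · exact hQP q hq f hf
      have h3 := Finset.card_sdiff_add_card_eq_card h2
      rw [Finset.card_union_of_disjoint hdis, Finset.card_erase_of_mem hq, hQ4] at h3
      exact h3.le.trans (hD q hq)
    have h2 : L q ∩ (confs d q \ Q).image c ⊆
        (L q ∩ P.image c₀) ∪ (confs d q \ (Q.erase q ∪ P)).image c := by
      intro t ht
      obtain ⟨htL, ht⟩ := Finset.mem_inter.1 ht
      obtain ⟨f, hf, rfl⟩ := Finset.mem_image.1 ht
      rw [Finset.mem_sdiff] at hf
      by_cases hfP : f ∈ P
      · refine Finset.mem_union_left _ (Finset.mem_inter.2 ⟨htL, ?_⟩)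
        rw [← himg]
        exact Finset.mem_image_of_mem c hfP
      · refine Finset.mem_union_right _ (Finset.mem_image_of_mem c ?_)
        simp only [Finset.mem_sdiff, Finset.mem_union, Finset.mem_erase]
        tauto
    have h3 := (Finset.card_le_card h2).trans (Finset.card_union_le _ _)
    have h4 : ((confs d q \ (Q.erase q ∪ P)).image c).card ≤ _ := Finset.card_image_le
    have h5 := Finset.card_sdiff_add_card_inter (L q) ((confs d q \ Q).image c)
    rw [hL q] at h5
    omega
  have hJ4 : J.card ≤ 4 := hQ4 ▸ Finset.card_le_card hJ
  have hJ1 : 0 < J.card := hJne.card_pos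
  have hsum : J.card * (β + 1) ≤ J.card * J.card + T := by
    have h1 : ∑ q ∈ J, (β + 1) ≤ ∑ q ∈ J, (J.card + (L q ∩ P.image c₀).card) :=
      Finset.sum_le_sum fun q hq => by
        have := hres q (hJ hq)
        have := hno q hq
        omega
    rw [Finset.sum_const, Finset.sum_add_distrib, Finset.sum_const, smul_eq_mul, smul_eq_mul] at h1
    have h2 := Finset.sum_le_sum_of_subset (f := fun q => (L q ∩ P.image c₀).card) hJ
    exact h1.trans (Nat.add_le_add_left (h2.trans hT) _)
  obtain ⟨q, hq⟩ := hJne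
  have hq1 := hres q (hJ hq)
  have hq2 := hno q hq
  have hq3 : (L q ∩ P.image c₀).card ≤ P.card :=
    (Finset.card_le_card Finset.inter_subset_right).trans Finset.card_image_le
  generalize hk : J.card = k at *
  -- A violator of size 1 is excluded by `hPβ`, since `P` blocks at most `P.card` colors; sizes 2,
  -- 3, 4 contradict `hsum` by `hT2`, `hT3`, `hT4`.
  interval_cases k <;> omega

end EndsMap

/-! ### Reduction to simple, triangle-free, 4-regular multigraphs. -/

namespace EndsMap

open scoped Classical

variable {V : Type u} {E : Type v} {γ : Type w} {d : E → Sym2 V} [Fintype E]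

/-- Coloring towards `x` never gets stuck: at each edge at most 21 colors are blocked. -/
lemma exists_properOn_univ_of_card_le (hd : MaxFour d) {L : E → Finset γ}
    (hL : ∀ e, (L e).card = 22) {x : V} {e : E} (hx : x ∈ d e)
    (h : ∀ f, x ∈ d f → (confs d f).card ≤ 21) (ih : ∃ c, ProperOn d L c (away d x)) :
    ∃ c, ProperOn d L c Finset.univ := by
  have : Nonempty γ := (Finset.card_pos.1 (by rw [hL e]; norm_num) : (L e).Nonempty).to_type
  obtain ⟨c, hc, -⟩ := exists_properOn_compl hd hL (s := x) (S := {x}) rfl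
    (by rintro _ rfl; rfl) (P := ∅) (Q := ∅) (c₀ := fun _ => Classical.arbitrary γ)
    ⟨by simp, by simp⟩ (by simp) (by simp) (by simp) (by simp)
    (fun y hy f hyf _ _ => by
      rw [Finset.sdiff_empty]
      exact h f (hy ▸ hyf)) ih
  exact ⟨c, by simpa using hc⟩

lemma exists_properOn_univ_of_card_inc (hd : MaxFour d) {L : E → Finset γ}
    (hL : ∀ e, (L e).card = 22) {x : V} {e : E} (hx : x ∈ d e) (h : (inc d x).card ≤ 3)
    (ih : ∃ c, ProperOn d L c (away d x)) : ∃ c, ProperOn d L c Finset.univ :=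
  exists_properOn_univ_of_card_le hd hL hx
    (fun _ hf => (card_confs_le_of_card_inc hd hf h).trans (by norm_num)) ih

lemma exists_properOn_univ_of_parallel (hd : MaxFour d) {L : E → Finset γ}
    (hL : ∀ e, (L e).card = 22) {x y : V} {e f : E} (hxy : x ≠ y) (he : d e = s(x, y))
    (hf : d f = s(x, y)) (hne : e ≠ f)
    (ih : ∃ c, ProperOn d L c (away d x)) : ∃ c, ProperOn d L c Finset.univ := by
  refine exists_properOn_univ_of_card_le hd hL (x := x) (e := e) (by simp [he]) (fun g hg => ?_) ih
  by_cases hge : g = e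
  · exact hge ▸ card_confs_le_of_parallel hd hxy he hf hne.symm
  by_cases hgf : g = f
  · exact hgf ▸ card_confs_le_of_parallel hd hxy hf he hne
  exact (card_confs_le_of_parallel_at hd hg he hf hne hge hgf).trans (by norm_num)

/-- The two triangle edges at `x` are kept for last. They have at most 20 conflicts each, so two
colors remain for each of them. -/
lemma exists_properOn_univ_of_triangle (hd : MaxFour d) {L : E → Finset γ}
    (hL : ∀ e, (L e).card = 22) {x y z : V} {e f g : E} (hxy : x ≠ y) (hxz : x ≠ z)
    (hyz : y ≠ z) (he : d e = s(x, y)) (hf : d f = s(x, z)) (hg : d g = s(y, z))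
    (ih : ∃ c, ProperOn d L c (away d x)) : ∃ c, ProperOn d L c Finset.univ := by
  have : Nonempty γ := (Finset.card_pos.1 (by rw [hL e]; norm_num) : (L e).Nonempty).to_type
  have hfe : f ≠ e := by
    rintro rfl
    exact hyz (Sym2.congr_right.1 (he.symm.trans hf))
  have hxg : x ∉ d g := by simp [hg, hxy, hxz]
  have hge : g ≠ e := fun h => hxg (by simp [h, he])
  have hgf : g ≠ f := fun h => hxg (by simp [h, hf])
  have hxef : ∀ k ∈ ({e, f} : Finset E), x ∈ d k := by
    intro k hk
    rcases Finset.mem_insert.1 hk with rfl | hk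
    · simp [he]
    · simp [Finset.mem_singleton.1 hk, hf]
  obtain ⟨c, hc, -⟩ := exists_properOn_compl hd hL (s := x) (S := {x}) rfl
    (by rintro _ rfl; rfl) (P := ∅) (Q := {e, f}) (c₀ := fun _ => Classical.arbitrary γ)
    ⟨by simp, by simp⟩ (by simp) (by simp) (by simp) (fun k hk => ⟨x, rfl, hxef k hk⟩)
    (by
      rintro _ rfl k hk - hkQ
      have hke : e ≠ k := fun h => hkQ (by simp [h])
      have hkf : f ≠ k := fun h => hkQ (by simp [h])
      -- The triangle edge `g` joins two vertices in the side of `k`, and `e`, `f` are still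
      -- uncolored: `24 - 1 - 2 = 21`.
      have h1 := card_confs_add_le hd (ends_eq_oth hk) {g} (by
        intro g' hg'
        rw [Finset.mem_singleton.1 hg']
        exact ⟨y, Finset.mem_union_left _ (mem_side he hke), z,
          Finset.mem_union_left _ (mem_side hf hkf), hyz, hg⟩)
      have h2 := Finset.card_sdiff_add_card_eq_card (s := {e, f}) (t := confs d k) (by
        intro k' hk'
        rw [mem_confs]
        exact conf_of_mem (fun h => hkQ (h ▸ hk')) hk (hxef k' hk'))
      rw [Finset.card_pair hfe.symm] at h2
      rw [Finset.card_singleton] at h1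
      omega) ih
  refine hc.exists_complete fun J hJ hJne => ?_
  obtain ⟨q, hq⟩ := hJne
  refine ⟨q, hq, ?_⟩
  have h1 : (confs d q).card ≤ 20 := by
    rcases Finset.mem_insert.1 (hJ hq) with rfl | h
    · exact card_confs_le_of_triangle hd he hf hg hfe hge
    · rw [Finset.mem_singleton.1 h]
      exact card_confs_le_of_triangle hd hf he (hg.trans Sym2.eq_swap) hfe.symm hgf
  have h2 : ((confs d q \ {e, f}).image c).card ≤ 20 :=
    (Finset.card_image_le.trans (Finset.card_le_card Finset.sdiff_subset)).trans h1
  have h3 := Finset.le_card_sdiff ((confs d q \ {e, f}).image c) (L q)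
  have h4 := (Finset.card_le_card hJ).trans Finset.card_le_two
  rw [hL q] at h3
  omega

/-- Simple triangle-free multigraphs that are regular of degree four apart from isolated
vertices. -/
structure IsTame (d : E → Sym2 V) : Prop extends MaxFour d where
  card_eq : ∀ x e, x ∈ d e → (inc d x).card = 4
  no_loop : ∀ x e, d e ≠ s(x, x)
  inj : ∀ e f, d e = d f → e = f
  no_triangle : ∀ x y z, (simple d).Adj x y → (simple d).Adj y z → ¬ (simple d).Adj x z

lemma IsTame.adj (hd : IsTame d) {x y : V} {e : E} (h : d e = s(x, y)) : (simple d).Adj x y := by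
  refine simple_adj.2 ⟨?_, e, by simp [h], by simp [h]⟩
  rintro rfl
  exact hd.no_loop x e h

/-- The tame case is the only one left. -/
lemma exists_properOn_univ_of_not_isTame (hd : MaxFour d) {L : E → Finset γ}
    (hL : ∀ e, (L e).card = 22) (ih : ∀ s e, s ∈ d e → ∃ c, ProperOn d L c (away d s))
    (h : ¬ IsTame d) : ∃ c, ProperOn d L c Finset.univ := by
  by_contra hno
  have hcard : ∀ x e, x ∈ d e → (inc d x).card = 4 := by
    intro x e hx
    by_contra h4
    have := hd.card_le x
    exact hno (exists_properOn_univ_of_card_inc hd hL hx (by omega) (ih x e hx))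
  have hloop : ∀ x e, d e ≠ s(x, x) := by
    intro x e hx
    have := hd.card_loop x e hx
    have := hcard x e (by simp [hx])
    omega
  refine h ⟨hd, hcard, hloop, fun e f hef => ?_, fun x y z hxy hyz hxz => ?_⟩
  · by_contra hne
    obtain ⟨x, y, he⟩ := exists_ends d e
    exact hno (exists_properOn_univ_of_parallel hd hL (fun h => hloop x e (by rw [he, h])) he
      (hef ▸ he) hne (ih x e (by simp [he])))
  · obtain ⟨e, he⟩ := exists_edge hxy
    obtain ⟨f, hf⟩ := exists_edge hxz
    obtain ⟨g, hg⟩ := exists_edge hyz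
    exact hno (exists_properOn_univ_of_triangle hd hL hxy.ne hxz.ne hyz.ne he hf hg
      (ih x e (by simp [he])))

end EndsMap

/-! ### Four-cycles: conflict counts and the common extension argument. -/

namespace EndsMap

open scoped Classical

variable {V : Type u} {E : Type v} {γ : Type w} {d : E → Sym2 V}

/-- A four-cycle of a multigraph. -/
structure FourCycle (d : E → Sym2 V) (a b c e : V) : Prop where
  ab : (simple d).Adj a b
  bc : (simple d).Adj b c
  ce : (simple d).Adj c e
  ea : (simple d).Adj e a
  ac : a ≠ c
  be : b ≠ e

lemma FourCycle.rotate {a b c e : V} (h : FourCycle d a b c e) : FourCycle d b c e a :=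
  ⟨h.bc, h.ce, h.ea, h.ab, h.be, h.ac.symm⟩

lemma FourCycle.card_edges {a b c e : V} (hC : FourCycle d a b c e) {q₁ q₂ q₃ q₄ : E}
    (h₁ : d q₁ = s(a, b)) (h₂ : d q₂ = s(b, c)) (h₃ : d q₃ = s(c, e)) (h₄ : d q₄ = s(e, a)) :
    ({q₁, q₂, q₃, q₄} : Finset E).card = 4 := by
  have hne_of : ∀ {p q : E} {x : V}, x ∈ d p → x ∉ d q → p ≠ q := fun hp hq h => hq (h ▸ hp)
  have h12 : q₁ ≠ q₂ := hne_of (x := a) (by simp [h₁]) (by simp [h₂, hC.ac, hC.ab.ne])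
  have h13 : q₁ ≠ q₃ := hne_of (x := a) (by simp [h₁]) (by simp [h₃, hC.ac, hC.ea.ne.symm])
  have h14 : q₁ ≠ q₄ := hne_of (x := b) (by simp [h₁]) (by simp [h₄, hC.be, hC.ab.ne.symm])
  have h23 : q₂ ≠ q₃ := hne_of (x := b) (by simp [h₂]) (by simp [h₃, hC.be, hC.bc.ne])
  have h24 : q₂ ≠ q₄ := hne_of (x := b) (by simp [h₂]) (by simp [h₄, hC.be, hC.ab.ne.symm])
  have h34 : q₃ ≠ q₄ := hne_of (x := c) (by simp [h₃]) (by simp [h₄, hC.ac.symm, hC.ce.ne])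
  rw [Finset.card_insert_of_notMem (by simp [h12, h13, h14]),
    Finset.card_eq_three.2 ⟨_, _, _, h23, h24, h34, rfl⟩]

variable [Fintype E]

lemma mem_side_of_adj {q : E} {a b z : V} (hq : d q = s(a, b)) (hz : (simple d).Adj a z)
    (hne : z ≠ b) : z ∈ side d q a := by
  obtain ⟨f, hf⟩ := exists_edge hz
  refine mem_side hf ?_
  rintro rfl
  exact hne (Sym2.congr_right.1 (hf.symm.trans hq))

section Bounds

variable {a b c e x y : V} {q : E}

/-- The opposite edge `ce` joins two vertices in the sides of `q` and is counted twice. -/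
lemma IsTame.card_confs_le_of_four_cycle (hd : IsTame d) (hq : d q = s(a, b))
    (hbc : (simple d).Adj b c) (hce : (simple d).Adj c e) (hae : (simple d).Adj a e)
    (hac : a ≠ c) (hbe : b ≠ e) : (confs d q).card ≤ 23 := by
  have hc := Finset.mem_union_right (side d q a)
    (mem_side_of_adj (hq.trans Sym2.eq_swap) hbc hac.symm)
  have he := Finset.mem_union_left (side d q b) (mem_side_of_adj hq hae hbe.symm)
  obtain ⟨f, hf⟩ := exists_edge hce
  have := card_confs_add_le hd.toMaxFour hq {f} (by
    intro g hg
    rw [Finset.mem_singleton.1 hg]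
    exact ⟨c, hc, e, he, hce.ne, hf⟩)
  rw [Finset.card_singleton] at this
  omega

/-- A further common neighbor `x` of `b` and `e` makes `ex` a second edge counted twice. -/
lemma IsTame.card_confs_le_of_common_neighbor (hd : IsTame d) (hq : d q = s(a, b))
    (hbc : (simple d).Adj b c) (hce : (simple d).Adj c e) (hae : (simple d).Adj a e)
    (hac : a ≠ c) (hbe : b ≠ e) (hbx : (simple d).Adj b x) (hex : (simple d).Adj e x)
    (hxa : x ≠ a) (hxc : x ≠ c) : (confs d q).card ≤ 22 := by
  have hc := Finset.mem_union_right (side d q a)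
    (mem_side_of_adj (hq.trans Sym2.eq_swap) hbc hac.symm)
  have hx := Finset.mem_union_right (side d q a)
    (mem_side_of_adj (hq.trans Sym2.eq_swap) hbx hxa)
  have he := Finset.mem_union_left (side d q b) (mem_side_of_adj hq hae hbe.symm)
  obtain ⟨f, hf⟩ := exists_edge hce
  obtain ⟨g, hg⟩ := exists_edge hex
  have hfg : f ≠ g := by
    rintro rfl
    have : c ∈ d f := by simp [hf]
    rw [hg, Sym2.mem_iff] at this
    exact this.elim hce.ne hxc.symm
  have := card_confs_add_le hd.toMaxFour hq {f, g} (by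
    intro k hk
    rcases Finset.mem_insert.1 hk with rfl | hk
    · exact ⟨c, hc, e, he, hce.ne, hf⟩
    · rw [Finset.mem_singleton.1 hk]
      exact ⟨e, he, x, hx, hex.ne, hg⟩)
  rw [Finset.card_pair hfg] at this
  omega

/-- The edges `ce`, `ex` and `cy` are counted twice. -/
lemma IsTame.card_confs_le_of_common_neighbors (hd : IsTame d) (hq : d q = s(a, b))
    (hbc : (simple d).Adj b c) (hce : (simple d).Adj c e) (hae : (simple d).Adj a e)
    (hac : a ≠ c) (hbe : b ≠ e) (hbx : (simple d).Adj b x) (hex : (simple d).Adj e x)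
    (hxa : x ≠ a) (hxc : x ≠ c) (hay : (simple d).Adj a y) (hcy : (simple d).Adj c y)
    (hyb : y ≠ b) (hye : y ≠ e) : (confs d q).card ≤ 21 := by
  have hc := Finset.mem_union_right (side d q a)
    (mem_side_of_adj (hq.trans Sym2.eq_swap) hbc hac.symm)
  have hx := Finset.mem_union_right (side d q a)
    (mem_side_of_adj (hq.trans Sym2.eq_swap) hbx hxa)
  have he := Finset.mem_union_left (side d q b) (mem_side_of_adj hq hae hbe.symm)
  have hy := Finset.mem_union_left (side d q b) (mem_side_of_adj hq hay hyb)
  obtain ⟨f, hf⟩ := exists_edge hce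
  obtain ⟨g, hg⟩ := exists_edge hex
  obtain ⟨h, hh⟩ := exists_edge hcy
  have hcg : c ∉ d g := by
    rw [hg, Sym2.mem_iff]
    exact fun h => h.elim hce.ne hxc.symm
  have hfg : f ≠ g := fun h => hcg (by rw [← h, hf]; simp)
  have hhg : g ≠ h := fun h' => hcg (by rw [h', hh]; simp)
  have hfh : f ≠ h := by
    rintro rfl
    exact hye (Sym2.congr_right.1 (hh.symm.trans hf))
  have := card_confs_add_le hd.toMaxFour hq {f, g, h} (by
    intro k hk
    rw [Finset.mem_insert, Finset.mem_insert, Finset.mem_singleton] at hk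
    rcases hk with rfl | rfl | rfl
    · exact ⟨c, hc, e, he, hce.ne, hf⟩
    · exact ⟨e, he, x, hx, hex.ne, hg⟩
    · exact ⟨c, hc, y, hy, hcy.ne, hh⟩)
  rw [Finset.card_eq_three.2 ⟨f, g, h, hfg, hfh, hhg, rfl⟩] at this
  omega

end Bounds

/-- Extending a coloring of a matching of edges at a four-cycle. -/
theorem FourCycle.exists_properOn_univ (hd : IsTame d) {L : E → Finset γ}
    (hL : ∀ e, (L e).card = 22) (ih : ∀ s e, s ∈ d e → ∃ c, ProperOn d L c (away d s))
    {a b c e : V} (hC : FourCycle d a b c e) {q₁ q₂ q₃ q₄ : E} (h₁ : d q₁ = s(a, b))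
    (h₂ : d q₂ = s(b, c)) (h₃ : d q₃ = s(c, e)) (h₄ : d q₄ = s(e, a)) {P : Finset E} {c₀ : E → γ}
    (hP : ProperOn d L c₀ P) (hPm : ∀ e ∈ P, ∀ f ∈ P, ∀ x, x ∈ d e → x ∈ d f → e = f)
    (hPS : ∀ p ∈ P, a ∈ d p ∨ b ∈ d p ∨ c ∈ d p ∨ e ∈ d p)
    (hPQ : ∀ p ∈ P, p ∉ ({q₁, q₂, q₃, q₄} : Finset E)) {D β T : ℕ}
    (hD : (confs d q₁).card ≤ D ∧ (confs d q₂).card ≤ D ∧ (confs d q₃).card ≤ D ∧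
      (confs d q₄).card ≤ D)
    (hT : ∑ q ∈ ({q₁, q₂, q₃, q₄} : Finset E), (L q ∩ P.image c₀).card ≤ T)
    (hβ : D + β ≤ 25 + P.card) (hPβ : P.card < β)
    (hT2 : T + 2 < 2 * β) (hT3 : T + 6 < 3 * β) (hT4 : T + 12 < 4 * β) :
    ∃ c, ProperOn d L c Finset.univ := by
  -- Every vertex of the cycle is equal or adjacent to an end of every cycle edge, so each edge at
  -- the cycle conflicts with all other cycle edges.
  have hnear : ∀ x ∈ ({a, b, c, e} : Set V), ∀ q ∈ ({q₁, q₂, q₃, q₄} : Finset E),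
      ∃ y ∈ d q, Near d x y := by
    have ab : Near d a b := ⟨q₁, by simp [h₁]⟩
    have bc : Near d b c := ⟨q₂, by simp [h₂]⟩
    have ce : Near d c e := ⟨q₃, by simp [h₃]⟩
    have ea : Near d e a := ⟨q₄, by simp [h₄]⟩
    intro x hx q hq
    simp only [Finset.mem_insert, Finset.mem_singleton] at hq
    simp only [Set.mem_insert_iff, Set.mem_singleton_iff] at hx
    rcases hx with rfl | rfl | rfl | rfl <;> rcases hq with rfl | rfl | rfl | rfl
    · exact ⟨b, by simp [h₁], ab⟩
    · exact ⟨b, by simp [h₂], ab⟩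
    · exact ⟨e, by simp [h₃], ea.symm⟩
    · exact ⟨e, by simp [h₄], ea.symm⟩
    · exact ⟨a, by simp [h₁], ab.symm⟩
    · exact ⟨c, by simp [h₂], bc⟩
    · exact ⟨c, by simp [h₃], bc⟩
    · exact ⟨a, by simp [h₄], ab.symm⟩
    · exact ⟨b, by simp [h₁], bc.symm⟩
    · exact ⟨b, by simp [h₂], bc.symm⟩
    · exact ⟨e, by simp [h₃], ce⟩
    · exact ⟨e, by simp [h₄], ce⟩
    · exact ⟨a, by simp [h₁], ea⟩
    · exact ⟨c, by simp [h₂], ce.symm⟩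
    · exact ⟨c, by simp [h₃], ce.symm⟩
    · exact ⟨a, by simp [h₄], ea⟩
  have hend : ∀ q ∈ ({q₁, q₂, q₃, q₄} : Finset E), ∃ x ∈ ({a, b, c, e} : Set V), x ∈ d q := by
    intro q hq
    simp only [Finset.mem_insert, Finset.mem_singleton] at hq
    rcases hq with rfl | rfl | rfl | rfl
    · exact ⟨a, by simp, by simp [h₁]⟩
    · exact ⟨b, by simp, by simp [h₂]⟩
    · exact ⟨c, by simp, by simp [h₃]⟩
    · exact ⟨e, by simp, by simp [h₄]⟩
  have hconf : ∀ x ∈ ({a, b, c, e} : Set V), ∀ f, x ∈ d f → ∀ q ∈ ({q₁, q₂, q₃, q₄} : Finset E),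
      f ≠ q → Conf d f q := by
    intro x hx f hf q hq hne
    obtain ⟨y, hy, hxy⟩ := hnear x hx q hq
    exact ⟨hne, x, hf, y, hy, hxy⟩
  have hPS' : ∀ p ∈ P, ∃ x ∈ ({a, b, c, e} : Set V), x ∈ d p := by
    intro p hp
    rcases hPS p hp with h | h | h | h
    · exact ⟨a, by simp, h⟩
    · exact ⟨b, by simp, h⟩
    · exact ⟨c, by simp, h⟩
    · exact ⟨e, by simp, h⟩
  have hreach : ∀ x ∈ ({a, b, c, e} : Set V), (simple d).Reachable a x := by
    intro x hx
    simp only [Set.mem_insert_iff, Set.mem_singleton_iff] at hx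
    rcases hx with rfl | rfl | rfl | rfl
    · rfl
    · exact hC.ab.reachable
    · exact hC.ab.reachable.trans hC.bc.reachable
    · exact hC.ea.symm.reachable
  have hQ4 := hC.card_edges h₁ h₂ h₃ h₄
  refine exists_properOn_univ_of_clique hd.toMaxFour hL (s := a) (S := {a, b, c, e}) (by simp)
    hreach hP hPm (fun p hp h => ?_) (Finset.disjoint_left.2 hPQ) hend
    (fun x hx f hf hfQ q hq => hconf x hx f hf q hq fun h => hfQ (h ▸ hq))
    (ih a q₁ (by simp [h₁])) hQ4 (fun f hf q hq hne => ?_) (fun q hq p hp => ?_) (fun q hq => ?_)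
    hT hβ hPβ hT2 hT3 hT4
  · obtain ⟨x, hx, hxp⟩ := hPS' p hp
    exact mem_away.1 h x hxp (hreach x hx)
  · obtain ⟨x, hx, hxf⟩ := hend f hf
    exact hconf x hx f hxf q hq hne
  · obtain ⟨x, hx, hxp⟩ := hPS' p hp
    exact (hconf x hx p hxp q hq fun h => hPQ p hp (h ▸ hq)).symm
  · simp only [Finset.mem_insert, Finset.mem_singleton] at hq
    rcases hq with rfl | rfl | rfl | rfl
    · exact hD.1
    · exact hD.2.1
    · exact hD.2.2.1
    · exact hD.2.2.2

/-- A vertex of a tame multigraph with two given neighbors has two more. -/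
lemma IsTame.exists_two_more (hd : IsTame d) {x a b : V} (ha : (simple d).Adj x a) :
    ∃ y z, (simple d).Adj x y ∧ (simple d).Adj x z ∧ y ≠ z ∧ y ≠ a ∧ y ≠ b ∧ z ≠ a ∧ z ≠ b := by
  obtain ⟨f, hf⟩ := exists_edge ha
  have h1 : ((inc d x).image (oth d x)).card = 4 := by
    rw [Finset.card_image_of_injOn, hd.card_eq x f (by simp [hf])]
    intro g hg h hh hgh
    have hg' := ends_eq_oth (mem_inc.1 hg)
    have hh' := ends_eq_oth (mem_inc.1 hh)
    refine hd.inj g h ?_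
    rw [hg', hh', hgh]
  have h2 : 1 < (((inc d x).image (oth d x)) \ {a, b}).card := by
    have := Finset.le_card_sdiff {a, b} ((inc d x).image (oth d x))
    have : ({a, b} : Finset V).card ≤ 2 := Finset.card_le_two
    omega
  obtain ⟨y, hy, z, hz, hyz⟩ := Finset.one_lt_card.1 h2
  have hadj : ∀ y ∈ (inc d x).image (oth d x), (simple d).Adj x y := by
    intro y hy
    obtain ⟨g, hg, rfl⟩ := Finset.mem_image.1 hy
    exact hd.adj (ends_eq_oth (mem_inc.1 hg))
  simp only [Finset.mem_sdiff, Finset.mem_insert, Finset.mem_singleton, not_or] at hy hz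
  exact ⟨y, z, hadj y hy.1, hadj z hz.1, hyz, hy.2.1, hy.2.2, hz.2.1, hz.2.2⟩

/-- A four-cycle whose two pairs of opposite vertices have further common neighbors. -/
lemma FourCycle.exists_properOn_univ_of_common_neighbors (hd : IsTame d) {L : E → Finset γ}
    (hL : ∀ e, (L e).card = 22) (ih : ∀ s e, s ∈ d e → ∃ c, ProperOn d L c (away d s))
    {a b c e x y : V} (hC : FourCycle d a b c e) (hbx : (simple d).Adj b x)
    (hex : (simple d).Adj e x) (hxa : x ≠ a) (hxc : x ≠ c) (hay : (simple d).Adj a y)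
    (hcy : (simple d).Adj c y) (hyb : y ≠ b) (hye : y ≠ e) :
    ∃ c, ProperOn d L c Finset.univ := by
  obtain ⟨q₁, h₁⟩ := exists_edge hC.ab
  obtain ⟨q₂, h₂⟩ := exists_edge hC.bc
  obtain ⟨q₃, h₃⟩ := exists_edge hC.ce
  obtain ⟨q₄, h₄⟩ := exists_edge hC.ea
  have : Nonempty γ := (Finset.card_pos.1 (by rw [hL q₁]; norm_num) : (L q₁).Nonempty).to_type
  -- With at most 21 conflicts, four colors remain for each cycle edge and no precoloring is needed.
  refine hC.exists_properOn_univ hd hL ih h₁ h₂ h₃ h₄ (P := ∅) (D := 21) (β := 4) (T := 0)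
    (c₀ := fun _ => Classical.arbitrary γ) ⟨by simp, by simp⟩ (by simp) (by simp) (by simp)
    ⟨?_, ?_, ?_, ?_⟩ (by simp) (by simp) (by simp) (by norm_num) (by norm_num) (by norm_num)
  · exact hd.card_confs_le_of_common_neighbors h₁ hC.bc hC.ce hC.ea.symm hC.ac hC.be hbx hex hxa
      hxc hay hcy hyb hye
  · exact hd.card_confs_le_of_common_neighbors (h₂.trans Sym2.eq_swap) hC.ab.symm hC.ea.symm hC.ce
      hC.ac.symm hC.be hbx hex hxc hxa hcy hay hyb hye
  · exact hd.card_confs_le_of_common_neighbors h₃ hC.ea hC.ab hC.bc.symm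
      hC.ac.symm hC.be.symm hex hbx hxc hxa hcy hay hye hyb
  · exact hd.card_confs_le_of_common_neighbors (h₄.trans Sym2.eq_swap) hC.ce.symm hC.bc.symm hC.ab
      hC.ac hC.be.symm hex hbx hxa hxc hay hcy hye hyb

/-- Opposite vertices of a four-cycle without further common neighbor are on edges that are not in
conflict, unless there is a four-cycle that has more common neighbors. -/
lemma FourCycle.exists_not_conf (hd : IsTame d) {a b c e : V} (hC : FourCycle d a b c e)
    (hno : ∀ a b c e x y, FourCycle d a b c e → (simple d).Adj b x → (simple d).Adj e x → x ≠ a →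
      x ≠ c → (simple d).Adj a y → (simple d).Adj c y → y ≠ b → y ≠ e → False)
    (hcom : ∀ x, (simple d).Adj a x → (simple d).Adj c x → x = b ∨ x = e) :
    ∃ u t p r, d p = s(a, u) ∧ d r = s(c, t) ∧ u ≠ b ∧ u ≠ e ∧ t ≠ b ∧ t ≠ e ∧
      p ≠ r ∧ ¬ Conf d p r := by
  have hnac : ¬ (simple d).Adj a c := hd.no_triangle a b c hC.ab hC.bc
  obtain ⟨u, t, hu, ht, hub, hue, htb, hte, hut⟩ : ∃ u t, (simple d).Adj a u ∧
      (simple d).Adj c t ∧ u ≠ b ∧ u ≠ e ∧ t ≠ b ∧ t ≠ e ∧ ¬ (simple d).Adj u t := by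
    obtain ⟨u, u', hu, hu', huu, hub, hue, hub', hue'⟩ := hd.exists_two_more (b := e) hC.ab
    obtain ⟨t, t', ht, ht', htt, htb, hte, htb', hte'⟩ := hd.exists_two_more (b := e) hC.bc.symm
    by_contra hall
    push Not at hall
    have h1 := hall u t hu ht hub hue htb hte
    have h2 := hall u t' hu ht' hub hue htb' hte'
    have h3 := hall u' t hu' ht hub' hue' htb hte
    have h4 := hall u' t' hu' ht' hub' hue' htb' hte'
    -- If all four pairs were adjacent, `u t u' t'` would be a four-cycle with further common
    -- neighbors `c` of `t`, `t'` and `a` of `u`, `u'`.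
    exact hno u t u' t' c a ⟨h1, h3.symm, h4, h2.symm, huu, htt⟩ ht.symm ht'.symm
      (fun h => hnac (h ▸ hu)) (fun h => hnac (h ▸ hu')) hu.symm hu'.symm
      (fun h => hnac (h ▸ ht).symm) (fun h => hnac (h ▸ ht').symm)
  obtain ⟨p, hp⟩ := exists_edge hu
  obtain ⟨r, hr⟩ := exists_edge ht
  refine ⟨u, t, p, r, hp, hr, hub, hue, htb, hte, ?_, ?_⟩
  · rintro rfl
    have : a ∈ d p := by simp [hp]
    rw [hr, Sym2.mem_iff] at this
    exact this.elim hC.ac fun h => hnac (h ▸ ht).symm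
  rintro ⟨-, x, hx, y, hy, hxy⟩
  rw [hp, Sym2.mem_iff] at hx
  rw [hr, Sym2.mem_iff] at hy
  have hct : ¬ (simple d).Adj a t := fun h => (hcom t h ht).elim htb hte
  have hcu : ¬ (simple d).Adj c u := fun h => (hcom u hu h).elim hub hue
  rcases hx with rfl | rfl <;> rcases hy with rfl | rfl <;> rcases hxy.eq_or_adj with h | h
  · exact hC.ac h
  · exact hnac h
  · exact hnac (h ▸ ht).symm
  · exact hct h
  · exact hnac (h ▸ hu)
  · exact hcu h.symm
  · exact hcu (h ▸ ht)
  · exact hut h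

end EndsMap

/-! ### Four-cycles lacking further common neighbors. -/

namespace EndsMap

open scoped Classical

variable {V : Type u} {E : Type v} {γ : Type w} {d : E → Sym2 V}

lemma FourCycle.ne_of_ends {a b c e u : V} (hC : FourCycle d a b c e) {q₁ q₂ q₃ q₄ p : E}
    (h₁ : d q₁ = s(a, b)) (h₂ : d q₂ = s(b, c)) (h₃ : d q₃ = s(c, e)) (h₄ : d q₄ = s(e, a))
    (hp : d p = s(a, u)) (hub : u ≠ b) (hue : u ≠ e) : p ≠ q₁ ∧ p ≠ q₂ ∧ p ≠ q₃ ∧ p ≠ q₄ := by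
  have ha : a ∈ d p := by simp [hp]
  refine ⟨?_, ?_, ?_, ?_⟩ <;> rintro rfl
  · exact hub (Sym2.congr_right.1 (hp.symm.trans h₁))
  · rw [h₂, Sym2.mem_iff] at ha
    exact ha.elim hC.ab.ne hC.ac
  · rw [h₃, Sym2.mem_iff] at ha
    exact ha.elim hC.ac hC.ea.ne.symm
  · exact hue (Sym2.congr_right.1 (hp.symm.trans (h₄.trans Sym2.eq_swap)))

lemma properOn_pair {L : E → Finset γ} {p r : E} (hpr : ¬ Conf d p r) {c : E → γ}
    (hp : c p ∈ L p) (hr : c r ∈ L r) : ProperOn d L c {p, r} := by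
  constructor
  · intro f hf
    rcases Finset.mem_insert.1 hf with rfl | hf
    · exact hp
    · rwa [Finset.mem_singleton.1 hf]
  · intro f hf g hg hfg
    rw [Finset.mem_insert, Finset.mem_singleton] at hf hg
    rcases hf with rfl | rfl <;> rcases hg with rfl | rfl
    · exact absurd rfl hfg.1
    · exact absurd hfg hpr
    · exact absurd hfg.symm hpr
    · exact absurd rfl hfg.1

lemma eq_of_mem_pair {p r : E} (hpr : ¬ Conf d p r) : ∀ e ∈ ({p, r} : Finset E),
    ∀ f ∈ ({p, r} : Finset E), ∀ x, x ∈ d e → x ∈ d f → e = f := by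
  intro f hf g hg x hxf hxg
  by_contra hne
  have h := conf_of_mem hne hxf hxg
  rw [Finset.mem_insert, Finset.mem_singleton] at hf hg
  rcases hf with rfl | rfl <;> rcases hg with rfl | rfl
  · exact h.1 rfl
  · exact hpr h
  · exact hpr h.symm
  · exact h.1 rfl

variable [Fintype E]

/-- By `hno`, the vertices `a` and `c` have no further common neighbor, so `exists_not_conf`
provides two edges to precolor; this makes up for the conflict lost (22 instead of 21). -/
lemma FourCycle.exists_properOn_univ_of_common_neighbor (hd : IsTame d) {L : E → Finset γ}
    (hL : ∀ e, (L e).card = 22) (ih : ∀ s e, s ∈ d e → ∃ c, ProperOn d L c (away d s))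
    (hno : ∀ a b c e x y, FourCycle d a b c e → (simple d).Adj b x → (simple d).Adj e x → x ≠ a →
      x ≠ c → (simple d).Adj a y → (simple d).Adj c y → y ≠ b → y ≠ e → False)
    {a b c e x : V} (hC : FourCycle d a b c e) (hbx : (simple d).Adj b x)
    (hex : (simple d).Adj e x) (hxa : x ≠ a) (hxc : x ≠ c) :
    ∃ c, ProperOn d L c Finset.univ := by
  obtain ⟨q₁, h₁⟩ := exists_edge hC.ab
  obtain ⟨q₂, h₂⟩ := exists_edge hC.bc
  obtain ⟨q₃, h₃⟩ := exists_edge hC.ce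
  obtain ⟨q₄, h₄⟩ := exists_edge hC.ea
  obtain ⟨u, t, p, r, hp, hr, hub, hue, htb, hte, hpr, hconf⟩ := hC.exists_not_conf hd hno
    fun y hay hcy => by
      by_contra hy
      push Not at hy
      exact hno a b c e x y hC hbx hex hxa hxc hay hcy hy.1 hy.2
  have hnp := hC.ne_of_ends h₁ h₂ h₃ h₄ hp hub hue
  have hnr := hC.rotate.rotate.ne_of_ends h₃ h₄ h₁ h₂ hr hte htb
  obtain ⟨k, hk, l, hl, hkl⟩ := exists_pair (A := L) (hC.card_edges h₁ h₂ h₃ h₄)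
    (fun q _ => hL q) (B := L p) (B' := L r) (by rw [hL]; norm_num) (by rw [hL]; norm_num)
  have hcard : ({p, r} : Finset E).card = 2 := Finset.card_pair hpr
  have himg : ({p, r} : Finset E).image (fun f => if f = p then k else l) = {k, l} := by
    simp [Finset.image_insert, hpr.symm]
  refine hC.exists_properOn_univ hd hL ih h₁ h₂ h₃ h₄ (P := {p, r}) (D := 22) (β := 5) (T := 4)
    (c₀ := fun f => if f = p then k else l)
    (properOn_pair hconf (by simpa using hk) (by simpa [hpr.symm] using hl))
    (eq_of_mem_pair hconf) ?_ ?_ ⟨?_, ?_, ?_, ?_⟩ (himg ▸ hkl) (by rw [hcard])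
    (by rw [hcard]; norm_num) (by norm_num) (by norm_num) (by norm_num)
  · simp [hp, hr]
  · simp [hnp, hnr]
  · exact hd.card_confs_le_of_common_neighbor h₁ hC.bc hC.ce hC.ea.symm hC.ac hC.be hbx hex hxa hxc
  · exact hd.card_confs_le_of_common_neighbor (h₂.trans Sym2.eq_swap) hC.ab.symm hC.ea.symm hC.ce
      hC.ac.symm hC.be hbx hex hxc hxa
  · exact hd.card_confs_le_of_common_neighbor h₃ hC.ea hC.ab hC.bc.symm
      hC.ac.symm hC.be.symm hex hbx hxc hxa
  · exact hd.card_confs_le_of_common_neighbor (h₄.trans Sym2.eq_swap) hC.ce.symm hC.bc.symm hC.ab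
      hC.ac hC.be.symm hex hbx hxa hxc

/-- Tame multigraphs with a four-cycle. -/
theorem FourCycle.exists_properOn_univ' (hd : IsTame d) {L : E → Finset γ}
    (hL : ∀ e, (L e).card = 22) (ih : ∀ s e, s ∈ d e → ∃ c, ProperOn d L c (away d s))
    {a b c e : V} (hC : FourCycle d a b c e) : ∃ c, ProperOn d L c Finset.univ := by
  by_contra hcol
  have hno : ∀ a b c e x y, FourCycle d a b c e → (simple d).Adj b x → (simple d).Adj e x →
      x ≠ a → x ≠ c → (simple d).Adj a y → (simple d).Adj c y → y ≠ b → y ≠ e → False :=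
    fun a b c e x y hC hbx hex hxa hxc hay hcy hyb hye =>
      hcol (hC.exists_properOn_univ_of_common_neighbors hd hL ih hbx hex hxa hxc hay hcy hyb hye)
  have hno' : ∀ a b c e, FourCycle d a b c e → ∀ x, (simple d).Adj b x → (simple d).Adj e x →
      x = a ∨ x = c := by
    intro a b c e hC x hbx hex
    by_contra hx
    push Not at hx
    exact hcol (hC.exists_properOn_univ_of_common_neighbor hd hL ih hno hbx hex hx.1 hx.2)
  obtain ⟨q₁, h₁⟩ := exists_edge hC.ab
  obtain ⟨q₂, h₂⟩ := exists_edge hC.bc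
  obtain ⟨q₃, h₃⟩ := exists_edge hC.ce
  obtain ⟨q₄, h₄⟩ := exists_edge hC.ea
  obtain ⟨u, t, p, r, hp, hr, hub, hue, htb, hte, hpr, hconf⟩ := hC.exists_not_conf hd hno
    fun x hax hcx => (hno' b c e a hC.rotate x hcx hax).imp id id
  obtain ⟨u', t', p', r', hp', hr', huc', hua', htc', hta', hpr', hconf'⟩ :=
    hC.rotate.exists_not_conf hd hno
      fun x hbx hex => (hno' a b c e hC x hbx hex).symm
  have hnp := hC.ne_of_ends h₁ h₂ h₃ h₄ hp hub hue
  have hnr := hC.rotate.rotate.ne_of_ends h₃ h₄ h₁ h₂ hr hte htb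
  have hnp' := hC.rotate.ne_of_ends h₂ h₃ h₄ h₁ hp' huc' hua'
  have hnr' := hC.rotate.rotate.rotate.ne_of_ends h₄ h₁ h₂ h₃ hr' hta' htc'
  /- Edges at consecutive vertices of the cycle have no common end. -/
  have hdis : ∀ {a b u v : V} {f g : E}, (simple d).Adj a b → d f = s(a, u) → d g = s(b, v) →
      u ≠ b → v ≠ a → ∀ x, x ∈ d f → x ∉ d g := by
    intro a b u v f g hab hf hg hub hva x hxf hxg
    rw [hf, Sym2.mem_iff] at hxf
    rw [hg, Sym2.mem_iff] at hxg
    rcases hxf with rfl | rfl <;> rcases hxg with h | h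
    · exact hab.ne h
    · exact hva h.symm
    · exact hub h
    · exact hd.no_triangle a b x hab (h ▸ hd.adj hg) (hd.adj hf)
  have hpp' := hdis hC.ab hp hp' hub hua'
  have hp'r := hdis hC.bc hp' hr huc' htb
  have hrr' := hdis hC.ce hr hr' hte htc'
  have hr'p := hdis hC.ea hr' hp hta' hue
  have hne : ∀ {f g : E}, (∀ x, x ∈ d f → x ∉ d g) → f ≠ g := by
    rintro f g h rfl
    obtain ⟨x, y, hf⟩ := exists_ends d f
    exact h x (by simp [hf]) (by simp [hf])
  obtain ⟨k, hk, l, hl, hkl⟩ := exists_pair (A := L) (hC.card_edges h₁ h₂ h₃ h₄)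
    (fun q _ => hL q) (B := L p) (B' := L r) (by rw [hL]; norm_num) (by rw [hL]; norm_num)
  -- Edges of `P` at consecutive cycle vertices do conflict, so the second pair avoids the colors of
  -- the first; this is why `exists_pair` asks only for 20 colors.
  have h20 : ∀ f, 20 ≤ (L f \ {k, l}).card := fun f => by
    have h1 := Finset.le_card_sdiff {k, l} (L f)
    have h2 : ({k, l} : Finset γ).card ≤ 2 := Finset.card_le_two
    rw [hL] at h1
    omega
  obtain ⟨k', hk', l', hl', hkl'⟩ := exists_pair (A := L) (hC.card_edges h₁ h₂ h₃ h₄)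
    (fun q _ => hL q) (h20 p') (h20 r')
  simp only [Finset.mem_sdiff, Finset.mem_insert, Finset.mem_singleton, not_or] at hk' hl'
  set c₀ : E → γ := fun f => if f = p then k else if f = r then l else if f = p' then k' else l'
    with hc₀
  have e1 : c₀ p = k := by simp [hc₀]
  have e2 : c₀ r = l := by simp [hc₀, hpr.symm]
  have e3 : c₀ p' = k' := by simp [hc₀, (hne hpp').symm, hne hp'r]
  have e4 : c₀ r' = l' := by simp [hc₀, hne hr'p, (hne hrr').symm, hpr'.symm]
  have himg : ({p, r, p', r'} : Finset E).image c₀ = {k, l} ∪ {k', l'} := by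
    ext x
    simp [e1, e2, e3, e4, eq_comm]
    tauto
  have hcard : ({p, r, p', r'} : Finset E).card = 4 := by
    rw [Finset.card_insert_of_notMem (by simp [hpr, hne hpp', (hne hr'p).symm]),
      Finset.card_eq_three.2 ⟨_, _, _, (hne hp'r).symm, hne hrr', hpr', rfl⟩]
  have hP := properOn_pair (L := L) (c := c₀) hconf (e1 ▸ hk) (e2 ▸ hl)
  have hP' := properOn_pair (L := L) (c := c₀) hconf' (e3 ▸ hk'.1) (e4 ▸ hl'.1)
  have hsplit : ({p, r, p', r'} : Finset E) = {p, r} ∪ {p', r'} := by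
    ext x
    simp
    tauto
  have hcol' : ∀ f ∈ ({p, r} : Finset E), ∀ g ∈ ({p', r'} : Finset E), c₀ f ≠ c₀ g := by
    simp only [Finset.mem_insert, Finset.mem_singleton]
    rintro f (rfl | rfl) g (rfl | rfl)
    · rw [e1, e3]
      exact fun h => hk'.2.1 h.symm
    · rw [e1, e4]
      exact fun h => hl'.2.1 h.symm
    · rw [e2, e3]
      exact fun h => hk'.2.2 h.symm
    · rw [e2, e4]
      exact fun h => hl'.2.2 h.symm
  have hends : ∀ f ∈ ({p, r} : Finset E), ∀ g ∈ ({p', r'} : Finset E), ∀ x, x ∈ d f → x ∉ d g := by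
    simp only [Finset.mem_insert, Finset.mem_singleton]
    rintro f (rfl | rfl) g (rfl | rfl)
    · exact hpp'
    · exact fun x h1 h2 => hr'p x h2 h1
    · exact fun x h1 h2 => hp'r x h2 h1
    · exact hrr'
  refine hcol (hC.exists_properOn_univ hd hL ih h₁ h₂ h₃ h₄ (P := {p, r, p', r'}) (D := 23)
    (β := 6) (T := 8) (c₀ := c₀) ?_ ?_ ?_ ?_ ⟨?_, ?_, ?_, ?_⟩ ?_ (by rw [hcard])
    (by rw [hcard]; norm_num) (by norm_num) (by norm_num) (by norm_num))
  · rw [hsplit]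
    refine ⟨fun f hf => (Finset.mem_union.1 hf).elim (hP.1 f) (hP'.1 f), fun f hf g hg hfg => ?_⟩
    rcases Finset.mem_union.1 hf with hf | hf <;> rcases Finset.mem_union.1 hg with hg | hg
    · exact hP.2 f hf g hg hfg
    · exact hcol' f hf g hg
    · exact (hcol' g hg f hf).symm
    · exact hP'.2 f hf g hg hfg
  · rw [hsplit]
    intro f hf g hg x hxf hxg
    rcases Finset.mem_union.1 hf with hf | hf <;> rcases Finset.mem_union.1 hg with hg | hg
    · exact eq_of_mem_pair hconf f hf g hg x hxf hxg
    · exact absurd hxg (hends f hf g hg x hxf)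
    · exact absurd hxf (hends g hg f hf x hxg)
    · exact eq_of_mem_pair hconf' f hf g hg x hxf hxg
  · simp [hp, hr, hp', hr']
  · simp [hnp, hnr, hnp', hnr']
  · exact hd.card_confs_le_of_four_cycle h₁ hC.bc hC.ce hC.ea.symm hC.ac hC.be
  · exact hd.card_confs_le_of_four_cycle h₂ hC.ce hC.ea hC.ab.symm hC.be hC.ac.symm
  · exact hd.card_confs_le_of_four_cycle h₃ hC.ea hC.ab hC.bc.symm hC.ac.symm hC.be.symm
  · exact hd.card_confs_le_of_four_cycle h₄ hC.ab hC.bc hC.ce.symm hC.be.symm hC.ac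
  · rw [himg]
    refine (Finset.sum_le_sum fun q _ => ?_).trans
      ((Finset.sum_add_distrib.trans_le (Nat.add_le_add hkl hkl')))
    rw [Finset.inter_union_distrib_left]
    exact Finset.card_union_le _ _

end EndsMap

/-! ### No four-cycle: precoloring an independent transversal around a vertex. -/

namespace EndsMap

open scoped Classical

/-- Three pairs joined by matchings without triangles have an independent transversal. -/
lemma exists_independent_triple {E : Type v} {r : E → E → Prop} {b b' c c' e e' : E}
    (h1 : ¬ (r b c ∧ r b c')) (h2 : ¬ (r b' c ∧ r b' c')) (h3 : ¬ (r b c ∧ r b' c))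
    (h4 : ¬ (r b c' ∧ r b' c')) (h5 : ¬ (r b e ∧ r b e')) (h6 : ¬ (r b' e ∧ r b' e'))
    (h7 : ¬ (r b e ∧ r b' e)) (h8 : ¬ (r b e' ∧ r b' e')) (h9 : ¬ (r c e ∧ r c e'))
    (h10 : ¬ (r c' e ∧ r c' e')) (h11 : ¬ (r c e ∧ r c' e)) (h12 : ¬ (r c e' ∧ r c' e'))
    (ht : ∀ x ∈ ({b, b'} : Set E), ∀ y ∈ ({c, c'} : Set E), ∀ z ∈ ({e, e'} : Set E),
      ¬ (r x y ∧ r y z ∧ r x z)) :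
    ∃ x ∈ ({b, b'} : Set E), ∃ y ∈ ({c, c'} : Set E), ∃ z ∈ ({e, e'} : Set E),
      ¬ r x y ∧ ¬ r y z ∧ ¬ r x z := by
  simp only [Set.mem_insert_iff, Set.mem_singleton_iff, forall_eq_or_imp, forall_eq,
    exists_eq_or_imp, exists_eq_left] at ht ⊢
  generalize r b c = p1 at *
  generalize r b c' = p2 at *
  generalize r b' c = p3 at *
  generalize r b' c' = p4 at *
  generalize r b e = p5 at *
  generalize r b e' = p6 at *
  generalize r b' e = p7 at *
  generalize r b' e' = p8 at *
  generalize r c e = p9 at *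
  generalize r c e' = p10 at *
  generalize r c' e = p11 at *
  generalize r c' e' = p12 at *
  -- A propositional check. When all three matchings are perfect, the relation forms a hexagon with
  -- the pairs as opposite vertices, and every second vertex gives the transversal.
  grind

/-- Four triples joined by matchings without triangles have an independent transversal. -/
theorem exists_independent_transversal {E : Type v} {r : E → E → Prop}
    (hr : ∀ a b, r a b → r b a) {Y : Fin 4 → Finset E} (hY : ∀ i, 3 ≤ (Y i).card)
    (hm : ∀ i j, i ≠ j → ∀ a ∈ Y i, ∀ b ∈ Y j, ∀ b' ∈ Y j, r a b → r a b' → b = b')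
    (ht : ∀ i j k, i ≠ j → j ≠ k → i ≠ k → ∀ a ∈ Y i, ∀ b ∈ Y j, ∀ c ∈ Y k,
      r a b → r b c → ¬ r a c) :
    ∃ a : Fin 4 → E, (∀ i, a i ∈ Y i) ∧ ∀ i j, i ≠ j → ¬ r (a i) (a j) := by
  -- Any `x` in the first set excludes at most one element of each other set, leaving three pairs.
  obtain ⟨x, hx⟩ : (Y 0).Nonempty := Finset.card_pos.1 (by have := hY 0; omega)
  have htwo : ∀ i, i ≠ 0 → ∃ b ∈ Y i, ∃ b' ∈ Y i, b ≠ b' ∧ ¬ r x b ∧ ¬ r x b' := by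
    intro i hi
    have h1 : ((Y i).filter (r x)).card ≤ 1 := by
      rw [Finset.card_le_one]
      intro b hb b' hb'
      rw [Finset.mem_filter] at hb hb'
      exact hm 0 i hi.symm x hx b hb.1 b' hb'.1 hb.2 hb'.2
    have h2 := Finset.card_filter_add_card_filter_not (s := Y i) (r x)
    have h3 : 1 < ((Y i).filter fun b => ¬ r x b).card := by
      have := hY i
      omega
    obtain ⟨b, hb, b', hb', hbb⟩ := Finset.one_lt_card.1 h3
    rw [Finset.mem_filter] at hb hb'
    exact ⟨b, hb.1, b', hb'.1, hbb, hb.2, hb'.2⟩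
  obtain ⟨b, hb, b', hb', hbb, hxb, hxb'⟩ := htwo 1 (by decide)
  obtain ⟨c, hc, c', hc', hcc, hxc, hxc'⟩ := htwo 2 (by decide)
  obtain ⟨e, he, e', he', hee, hxe, hxe'⟩ := htwo 3 (by decide)
  have hm1 : ∀ i j, i ≠ j → ∀ a ∈ Y i, ∀ b ∈ Y j, ∀ b' ∈ Y j, b ≠ b' → ¬ (r a b ∧ r a b') :=
    fun i j hij a ha b hb b' hb' hne h => hne (hm i j hij a ha b hb b' hb' h.1 h.2)
  have hm2 : ∀ i j, i ≠ j → ∀ a ∈ Y i, ∀ b ∈ Y j, ∀ b' ∈ Y j, b ≠ b' → ¬ (r b a ∧ r b' a) :=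
    fun i j hij a ha b hb b' hb' hne h =>
      hne (hm i j hij a ha b hb b' hb' (hr _ _ h.1) (hr _ _ h.2))
  have hsub : ∀ {i : Fin 4} {b b' : E}, b ∈ Y i → b' ∈ Y i → ∀ y ∈ ({b, b'} : Set E), y ∈ Y i := by
    rintro i b b' hb hb' y (rfl | rfl)
    · exact hb
    · exact hb'
  obtain ⟨y, hy, z, hz, t, ht', hyz, hzt, hyt⟩ := exists_independent_triple (r := r)
    (hm1 1 2 (by decide) b hb c hc c' hc' hcc) (hm1 1 2 (by decide) b' hb' c hc c' hc' hcc)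
    (hm2 2 1 (by decide) c hc b hb b' hb' hbb) (hm2 2 1 (by decide) c' hc' b hb b' hb' hbb)
    (hm1 1 3 (by decide) b hb e he e' he' hee) (hm1 1 3 (by decide) b' hb' e he e' he' hee)
    (hm2 3 1 (by decide) e he b hb b' hb' hbb) (hm2 3 1 (by decide) e' he' b hb b' hb' hbb)
    (hm1 2 3 (by decide) c hc e he e' he' hee) (hm1 2 3 (by decide) c' hc' e he e' he' hee)
    (hm2 3 2 (by decide) e he c hc c' hc' hcc) (hm2 3 2 (by decide) e' he' c hc c' hc' hcc)
    (fun y hy z hz t ht' h => ht 1 2 3 (by decide) (by decide) (by decide) y (hsub hb hb' y hy)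
      z (hsub hc hc' z hz) t (hsub he he' t ht') h.1 h.2.1 h.2.2)
  have hxy : ¬ r x y := by
    rcases hy with rfl | rfl
    · exact hxb
    · exact hxb'
  have hxz : ¬ r x z := by
    rcases hz with rfl | rfl
    · exact hxc
    · exact hxc'
  have hxt : ¬ r x t := by
    rcases ht' with rfl | rfl
    · exact hxe
    · exact hxe'
  have hs : ∀ {a b}, ¬ r a b → ¬ r b a := fun h h' => h (hr _ _ h')
  refine ⟨![x, y, z, t], fun i => ?_, fun i j hij => ?_⟩
  · fin_cases i
    · exact hx
    · exact hsub hb hb' y hy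
    · exact hsub hc hc' z hz
    · exact hsub he he' t ht'
  · fin_cases i <;> fin_cases j <;>
      first
        | exact absurd rfl hij
        | assumption
        | exact hs ‹_›

variable {V : Type u} {E : Type v} {γ : Type w} {d : E → Sym2 V} [Fintype E]

/-- Tame multigraphs without four-cycles. -/
theorem IsTame.exists_properOn_univ_of_no_four_cycle (hd : IsTame d) {L : E → Finset γ}
    (hL : ∀ e, (L e).card = 22) (ih : ∀ s e, s ∈ d e → ∃ c, ProperOn d L c (away d s))
    (hC : ∀ a b c e, ¬ FourCycle d a b c e) {v : V} {e : E} (hv : v ∈ d e) :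
    ∃ c, ProperOn d L c Finset.univ := by
  have hcard := hd.card_eq v e hv
  set φ := (inc d v).equivFinOfCardEq hcard
  set q : Fin 4 → E := fun i => φ.symm i with hq
  have hqv : ∀ i, v ∈ d (q i) := fun i => mem_inc.1 (φ.symm i).2
  have hqinj : ∀ i j, q i = q j → i = j := fun i j h => φ.symm.injective (Subtype.ext h)
  set w : Fin 4 → V := fun i => oth d v (q i) with hw
  have hqw : ∀ i, d (q i) = s(v, w i) := fun i => ends_eq_oth (hqv i)
  have hvw : ∀ i, (simple d).Adj v (w i) := fun i => hd.adj (hqw i)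
  have hwinj : ∀ i j, w i = w j → i = j := fun i j h =>
    hqinj i j (hd.inj _ _ (by rw [hqw, hqw, h]))
  have hww : ∀ i j, ¬ (simple d).Adj (w i) (w j) := fun i j h =>
    hd.no_triangle v (w i) (w j) (hvw i) h (hvw j)
  set Y : Fin 4 → Finset E := fun i => (inc d (w i)).erase (q i) with hY
  have hYends : ∀ i, ∀ a ∈ Y i, ∃ x, d a = s(w i, x) ∧ x ≠ v := by
    intro i a ha
    rw [hY, Finset.mem_erase, mem_inc] at ha
    refine ⟨_, ends_eq_oth ha.2, fun h => ha.1 (hd.inj _ _ ?_)⟩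
    rw [ends_eq_oth ha.2, h, hqw i, Sym2.eq_swap]
  have hYcard : ∀ i, 3 ≤ (Y i).card := by
    intro i
    have hmem : q i ∈ inc d (w i) := by simp [hqw i]
    have h4 := hd.card_eq (w i) (q i) (mem_inc.1 hmem)
    simp only [hY]
    rw [Finset.card_erase_of_mem hmem]
    omega
  have hno : ∀ i j, i ≠ j → ∀ x, x ≠ v → (simple d).Adj (w i) x → ¬ (simple d).Adj (w j) x :=
    fun i j hij x hx hix hjx => hC v (w i) x (w j)
      ⟨hvw i, hix, hjx.symm, (hvw j).symm, hx.symm, fun h => hij (hwinj i j h)⟩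
  -- The two edges can only be joined at their far ends: any other connection closes a triangle, or
  -- a four-cycle through `v`.
  have hconf : ∀ i j, i ≠ j → ∀ a b x y, d a = s(w i, x) → d b = s(w j, y) → x ≠ v → y ≠ v →
      Conf d a b → (simple d).Adj x y := by
    rintro i j hij a b x y ha hb hx hy ⟨-, s, hs, t, ht, hst⟩
    have hix := hd.adj ha
    have hjy := hd.adj hb
    rw [ha, Sym2.mem_iff] at hs
    rw [hb, Sym2.mem_iff] at ht
    rcases hs with rfl | rfl <;> rcases ht with rfl | rfl <;> rcases hst.eq_or_adj with h | h
    · exact absurd (hwinj i j h) hij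
    · exact absurd h (hww i j)
    · exact absurd (h ▸ hjy) (hww j i)
    · exact absurd hjy (hno i j hij t hy h)
    · exact absurd (h ▸ hix) (hww i j)
    · exact absurd h.symm (hno i j hij s hx hix)
    · exact absurd (h ▸ hjy) (hno i j hij s hx hix)
    · exact h
  obtain ⟨a, haY, ha⟩ := exists_independent_transversal (r := Conf d)
    (fun _ _ h => h.symm) hYcard
    (by
      intro i j hij a ha b hb b' hb' hab hab'
      obtain ⟨x, hax, hx⟩ := hYends i a ha
      obtain ⟨y, hby, hy⟩ := hYends j b hb
      obtain ⟨y', hby', hy'⟩ := hYends j b' hb'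
      have h1 := hconf i j hij a b x y hax hby hx hy hab
      have h2 := hconf i j hij a b' x y' hax hby' hx hy' hab'
      -- Otherwise `x y (w j) y'` is a four-cycle.
      have hyy : y = y' := by
        by_contra hne
        exact hC x y (w j) y' ⟨h1, (hd.adj hby).symm, hd.adj hby', h2.symm,
          fun h => hww i j (h ▸ hd.adj hax), hne⟩
      exact hd.inj _ _ (by rw [hby, hby', hyy]))
    (by
      intro i j k hij hjk hik a ha b hb c hc hab hbc hac
      obtain ⟨x, hax, hx⟩ := hYends i a ha
      obtain ⟨y, hby, hy⟩ := hYends j b hb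
      obtain ⟨z, hcz, hz⟩ := hYends k c hc
      exact hd.no_triangle x y z (hconf i j hij a b x y hax hby hx hy hab)
        (hconf j k hjk b c y z hby hcz hy hz hbc) (hconf i k hik a c x z hax hcz hx hz hac))
  have haw : ∀ i, w i ∈ d (a i) := fun i => mem_inc.1 (Finset.mem_of_mem_erase (haY i))
  have hav : ∀ i, v ∉ d (a i) := by
    intro i h
    obtain ⟨x, hax, hx⟩ := hYends i _ (haY i)
    rw [hax, Sym2.mem_iff] at h
    exact h.elim (hvw i).ne hx.symm
  have hainj : Function.Injective a := by
    intro i j hij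
    by_contra hne
    have h1 := haw j
    rw [← hij] at h1
    have h2 : d (a i) = s(w i, w j) :=
      (Sym2.mem_and_mem_iff fun h => hne (hwinj i j h)).1 ⟨haw i, h1⟩
    exact hww i j (hd.adj h2)
  obtain ⟨c, hc, hcT⟩ := exists_quadruple (A := L) hcard (fun q _ => hL q)
    (B := fun i => L (a i)) fun i => hL (a i)
  have hPcard : (Finset.univ.image a).card = 4 := by
    rw [Finset.card_image_of_injective _ hainj, Finset.card_univ, Fintype.card_fin]
  have hc₀ : ∀ i, Function.extend a c (fun _ => c 0) (a i) = c i := fun i =>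
    hainj.extend_apply c _ i
  have himg : (Finset.univ.image a).image (Function.extend a c fun _ => c 0) =
      Finset.univ.image c := by
    rw [Finset.image_image]
    exact Finset.image_congr fun i _ => hc₀ i
  have hmemP : ∀ f ∈ Finset.univ.image a, ∃ i, a i = f := fun f hf => by simpa using hf
  -- Here `24 + 5 = 25 + 4`, and `T = 7` is the largest value with `T + 2 < 2 * 5` and `T + 12 < 4 *
  -- 5`; hence the effort to get 7 in `exists_quadruple`.
  refine exists_properOn_univ_of_clique hd.toMaxFour hL (s := v) (S := {v}) rfl
    (by rintro _ rfl; rfl) (P := Finset.univ.image a) (Q := inc d v)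
    (c₀ := Function.extend a c fun _ => c 0) (D := 24) (β := 5) (T := 7)
    ⟨?_, ?_⟩ ?_ ?_ ?_ ?_ ?_ (ih v e hv) hcard ?_ ?_ (fun f _ => card_confs_le hd.toMaxFour f)
    (himg ▸ hcT) (by rw [hPcard]) (by rw [hPcard]; norm_num) (by norm_num) (by norm_num)
    (by norm_num)
  · intro f hf
    obtain ⟨i, rfl⟩ := hmemP f hf
    rw [hc₀]
    exact hc i
  · intro f hf g hg hfg
    obtain ⟨i, rfl⟩ := hmemP f hf
    obtain ⟨j, rfl⟩ := hmemP g hg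
    exact absurd hfg (ha i j fun h => hfg.1 (congrArg a h))
  · intro f hf g hg x hxf hxg
    obtain ⟨i, rfl⟩ := hmemP f hf
    obtain ⟨j, rfl⟩ := hmemP g hg
    by_contra hne
    exact ha i j (fun h => hne (congrArg a h)) (conf_of_mem hne hxf hxg)
  · intro f hf h
    obtain ⟨i, rfl⟩ := hmemP f hf
    exact mem_away.1 h (w i) (haw i) (hvw i).reachable
  · rw [Finset.disjoint_left]
    intro f hf h
    obtain ⟨i, rfl⟩ := hmemP f hf
    exact hav i (mem_inc.1 h)
  · exact fun f hf => ⟨v, rfl, mem_inc.1 hf⟩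
  · rintro _ rfl f hf hfQ
    exact absurd (mem_inc.2 hf) hfQ
  · intro f hf g hg hne
    exact conf_of_mem hne (mem_inc.1 hf) (mem_inc.1 hg)
  · intro f hf g hg
    obtain ⟨i, rfl⟩ := hmemP g hg
    refine ⟨fun h => hav i (h ▸ mem_inc.1 hf), v, mem_inc.1 hf, w i, haw i, q i, ?_, ?_⟩ <;>
      simp [hqw i]

/-- Strong list colorings of multigraphs given by the ends of their edges. -/
theorem MaxFour.exists_properOn_univ (hd : MaxFour d) {L : E → Finset γ}
    (hL : ∀ e, (L e).card = 22) : ∃ c, ProperOn d L c Finset.univ := by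
  refine exists_properOn_univ_of_step (fun E _ d L hd hL ih => ?_) (Fintype.card E) E d L hd hL rfl
  by_cases hT : IsTame d
  · by_cases hC : ∃ a b c e, FourCycle d a b c e
    · obtain ⟨a, b, c, e, hC⟩ := hC
      exact hC.exists_properOn_univ' hT hL ih
    · push Not at hC
      rcases isEmpty_or_nonempty E with hE | ⟨⟨e⟩⟩
      · exact ⟨isEmptyElim, by simp [ProperOn]⟩
      · obtain ⟨x, y, he⟩ := exists_ends d e
        exact hT.exists_properOn_univ_of_no_four_cycle hL ih hC (v := x) (e := e) (by simp [he])
  · exact exists_properOn_univ_of_not_isTame hd hL ih hT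

end EndsMap

/-! ### Translation from `Graph` to the map of ends. -/

namespace Graph

variable {α : Type u} {β : Type v} {G : Graph α β}

lemma degree_le_four (hdeg : G.maxDegree ≤ 4) {x : α} (hx : x ∈ V(G)) :
    (G.incidenceSet x).encard + (G.loopSet x).encard ≤ 4 :=
  (le_iSup₂ (f := fun v (_ : v ∈ V(G)) => G.degree v) x hx).trans hdeg

lemma finite_edgeSet (hfin : V(G).Finite) (hdeg : G.maxDegree ≤ 4) : E(G).Finite := by
  refine (hfin.biUnion (t := fun x => G.incidenceSet x) fun x hx => ?_).subset fun e he => ?_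
  · refine Set.finite_of_encard_le_coe (k := 4) ?_
    exact le_self_add.trans (degree_le_four hdeg hx)
  · obtain ⟨x, y, h⟩ := exists_isLink_of_mem_edgeSet he
    exact Set.mem_biUnion h.left_mem h.inc_left

end Graph

theorem theorem1 {α : Type u} {β : Type v} (G : Graph α β) (hfin : V(G).Finite)
    (hdeg : G.maxDegree ≤ 4) : Graph.IsStronglyEdgeChoosable.{u, v, w} G 22 := by
  classical
  intro γ L hL
  have : Fintype E(G) := (Graph.finite_edgeSet hfin hdeg).fintype
  have hends : ∀ e : E(G), ∃ p : α × α, G.IsLink e p.1 p.2 := fun e => by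
    obtain ⟨x, y, h⟩ := Graph.exists_isLink_of_mem_edgeSet e.2
    exact ⟨(x, y), h⟩
  choose p hp using hends
  set d : E(G) → Sym2 α := fun e => s((p e).1, (p e).2) with hd
  have hmem : ∀ (e : E(G)) x, x ∈ d e ↔ G.Inc e x := fun e x => by
    rw [hd, Sym2.mem_iff]
    constructor
    · rintro (rfl | rfl)
      · exact (hp e).inc_left
      · exact (hp e).inc_right
    · exact fun h => h.eq_or_eq_of_isLink (hp e)
  have hcard : ∀ x, ((EndsMap.inc d x).card : ℕ∞) ≤ (G.incidenceSet x).encard := fun x => by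
    rw [← Finset.card_map (Function.Embedding.subtype _), ← Set.encard_coe_eq_coe_finsetCard]
    refine Set.encard_le_encard fun e he => ?_
    obtain ⟨f, hf, rfl⟩ := Finset.mem_map.1 (Finset.mem_coe.1 he)
    exact (hmem f x).1 (EndsMap.mem_inc.1 hf)
  have hmax : EndsMap.MaxFour d := by
    constructor
    · intro x
      by_cases hx : x ∈ V(G)
      · have := (hcard x).trans (le_self_add.trans (Graph.degree_le_four hdeg hx))
        exact_mod_cast this
      · rw [Finset.card_eq_zero.2]
        · norm_num
        · refine Finset.eq_empty_of_forall_notMem fun e he => hx ?_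
          exact ((hmem e x).1 (EndsMap.mem_inc.1 he)).vertex_mem
    · intro x e he
      have hloop : G.IsLoopAt e x := by
        have h := hp e
        rcases Sym2.eq_iff.1 he with ⟨h1, h2⟩ | ⟨h1, h2⟩ <;> rwa [h1, h2] at h
      have h1 : (1 : ℕ∞) ≤ (G.loopSet x).encard :=
        Set.one_le_encard_iff_nonempty.2 ⟨e, hloop⟩
      -- A loop contributes twice to the degree, so at most three edges fit at its vertex.
      have h2 := (add_le_add (hcard x) h1).trans (Graph.degree_le_four hdeg hloop.vertex_mem)
      have h3 : (EndsMap.inc d x).card + 1 ≤ 4 := by exact_mod_cast h2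
      omega
  choose L' hL' hL'card using fun e => Finset.exists_subset_card_eq (hL e)
  obtain ⟨c, hc⟩ := hmax.exists_properOn_univ hL'card
  refine ⟨c, fun e f hef hadj => hc.2 e (Finset.mem_univ e) f (Finset.mem_univ f) ?_,
    fun e => hL' e (hc.1 e (Finset.mem_univ e))⟩
  rcases hadj with ⟨-, x, hex, hfx⟩ | ⟨g, ⟨-, x, hex, hgx⟩, -, y, hfy, hgy⟩
  · exact EndsMap.conf_of_mem hef ((hmem e x).2 hex) ((hmem f x).2 hfx)
  · exact ⟨hef, x, (hmem e x).2 hex, y, (hmem f y).2 hfy, ⟨g, hgx.edge_mem⟩,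
      (hmem _ x).2 hgx, (hmem _ y).2 hgy⟩
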